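/- **Proposition 5.4.** *Setting.* Let $\varphi=dx_{123}+dx_{145}+dx_{167}+dx_{246}-dx_{257}-dx_{347}-dx_{356}$ on $\mathbb{R}^7$, let $\times$ be the cross product with $g(x\times y,z)=\varphi(x,y,z)$, and let $\chi$ be the $\mathbb{R}^7$-valued 3-form with $g(\chi(x,y,z),w)=*\varphi(x,y,z,w)$. For $\sigma\in\mathcal{S}^6$ put $J_\sigma u=\sigma\times u$ on $T_\sigma\mathcal{S}^6$, and let $\zeta_\sigma=\chi(\sigma,\cdot,\cdot)$ (so that $\chi=r^2\xi+r\,dr\wedge\zeta$ on $\mathbb{R}^7\setminus\{0\}$). Let $\Sigma\subset\mathcal{S}^6$ be a compact smooth embedded surface (without boundary) such that the cone $C=\{r\sigma: r>0,\ \sigma\in\Sigma\}$ is an associative 3-fold, that is, $\varphi|_C=\mathrm{vol}_C$ for a suitable orientation of $C$; orient $C$ in this way and $\Sigma$ so that $\varphi(\sigma,\cdot,\cdot)|_{T_\sigma\Sigma}=\mathrm{vol}_\Sigma$. For a submanifold $P$ of $M$ let $\nu(P)$ be its normal bundle in $M$ and let $d^\perp_P$ be the exterior covariant derivative on $\nu(P)$-valued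 forms on $P$ for the connection induced on $\nu(P)$ by the Levi-Civita connection of $M$; here $C\subset\mathbb{R}^7$ and $\Sigma\subset\mathcal{S}^6$. Define $$D_C v=*\,d_C^\perp (v\cdot\chi)|_C\ \text{ on } C^\infty(\nu(C)),\qquad D_\Sigma v=*_\Sigma d_\Sigma^\perp (v\cdot\zeta)|_\Sigma,\quad \bar\partial_\Sigma=J D_\Sigma\ \text{ on } C^\infty(\nu(\Sigma)),$$ where $v\cdot$ denotes contraction with $v$ in the first slot. For $\mu\in\mathbb{R}$ let $D(\mu)=\{v\in C^\infty(\nu(\Sigma)):\bar\partial_\Sigma v=(\mu+1)v\}$, and let $d(\mu)$ be the dimension of the space of normal vector fields $v_C$ on $C$ with $D_Cv_C=0$ that have the form $$v_C(r\sigma)=r^{\mu-1}\sum_{j=0}^m(\log r)^j v_j(\sigma)\quad(r>0,\ \sigma\in\Sigma),\qquad m\in\mathbb{N},\ v_j\in C^\infty(\nu(\Sigma)),$$ where $\nu_{r\sigma}(C)$ and $\nu_\sigma(\Sigma)$ are identified as the same subspace of $\mathbb{R}^7$. *Claim.* For every $\mu\in\mathbb{R}$, solutions of this form contain no logarithmic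 terms: in any such solution $v_j=0$ for all $j\ge 1$, and $v_0\in D(\mu)$. Moreover $d(\mu)=\dim D(\mu)$. -/

import Mathlib

open Set
open scoped ContDiff

noncomputable section

namespace AssocCone

/-- Euclidean `ℝ⁷` (identified with the imaginary octonions). The coordinates `x₁, …, x₇` are indexed
by `Fin 7` modulo `7`: the numeral `7 : Fin 7` is `0`, so `x₇` is the coordinate with index `0`. -/
abbrev R7 : Type := EuclideanSpace ℝ (Fin 7)

/-- The standard basis vectors `e_i` of `ℝ⁷`. -/
def stdVec (i : Fin 7) : R7 := EuclideanSpace.single i 1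

/-! ### The forms `φ`, `*φ`, `χ` and the cross product -/

/-- The coordinate form `dx_{I 0} ∧ ⋯ ∧ dx_{I (k-1)}` (see `dx_apply`). -/
def dx {k : ℕ} (I : Fin k → Fin 7) : R7 [⋀^Fin k]→L[ℝ] ℝ :=
  { (Matrix.detRowAlternating (n := Fin k) (R := ℝ)).compLinearMap
      (LinearMap.funLeft ℝ ℝ I ∘ₗ (WithLp.linearEquiv 2 ℝ (Fin 7 → ℝ)).toLinearMap) with
    cont := by
      change Continuous fun v : Fin k → R7 => Matrix.det (Matrix.of fun a b => v a (I b))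
      refine Continuous.matrix_det (continuous_matrix fun a b => ?_)
      simp only [Matrix.of_apply]
      fun_prop }

theorem dx_apply {k : ℕ} (I : Fin k → Fin 7) (v : Fin k → R7) :
    dx I v = Matrix.det (Matrix.of fun a b => v a (I b)) := rfl

/-- The associative calibration `φ` on `ℝ⁷`. -/
def phi : R7 [⋀^Fin 3]→L[ℝ] ℝ :=
  dx ![1, 2, 3] + dx ![1, 4, 5] + dx ![1, 6, 7] + dx ![2, 4, 6] - dx ![2, 5, 7]
    - dx ![3, 4, 7] - dx ![3, 5, 6]

/-- The Hodge dual `*φ` of `φ` on `ℝ⁷`. -/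
def starPhi : R7 [⋀^Fin 4]→L[ℝ] ℝ :=
  dx ![4, 5, 6, 7] + dx ![2, 3, 6, 7] + dx ![2, 3, 4, 5] + dx ![1, 3, 5, 7] - dx ![1, 3, 4, 6]
    - dx ![1, 2, 5, 6] - dx ![1, 2, 4, 7]

/-- The `ℝ⁷`-valued 3-form `χ`, given by `⟨χ(x,y,z), w⟩ = *φ(x,y,z,w)` (see `inner_chi`). The sign
comes from moving `w` from the last slot of `*φ` to the first one. -/
def chi : R7 [⋀^Fin 3]→L[ℝ] R7 :=
  -∑ i : Fin 7, (starPhi.curryLeft (stdVec i)).smulRight (stdVec i)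

theorem sum_coord_smul_stdVec (w : R7) : ∑ i : Fin 7, w i • stdVec i = w := by
  ext j
  simp [stdVec, Finset.sum_apply, Pi.single_apply]

theorem curryLeft_vec (f : R7 [⋀^Fin 4]→L[ℝ] ℝ) (w x y z : R7) :
    f.curryLeft w ![x, y, z] = f ![w, x, y, z] := rfl

theorem rotate_vec (f : R7 [⋀^Fin 4]→L[ℝ] ℝ) (w x y z : R7) :
    f ![w, x, y, z] = -f ![x, y, z, w] := by
  have h4 := f.toAlternatingMap.map_perm ![x, y, z, w] (finRotate 4).symm
  have h5 : (![x, y, z, w] ∘ (finRotate 4).symm : Fin 4 → R7) = ![w, x, y, z] := by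
    funext i
    fin_cases i <;> rfl
  rw [h5] at h4
  simpa [Equiv.Perm.sign_symm, sign_finRotate, pow_succ] using h4

/-- The defining property of `χ`. -/
theorem inner_chi (x y z w : R7) : inner ℝ (chi ![x, y, z]) w = starPhi ![x, y, z, w] := by
  have h2 : starPhi.curryLeft w ![x, y, z]
      = ∑ i : Fin 7, w i * starPhi.curryLeft (stdVec i) ![x, y, z] := by
    conv_lhs => rw [← sum_coord_smul_stdVec w]
    simp only [map_sum, map_smul, ContinuousAlternatingMap.sum_apply,
      ContinuousAlternatingMap.smul_apply, smul_eq_mul]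
  rw [← neg_neg (starPhi ![x, y, z, w]), ← rotate_vec, ← curryLeft_vec, h2]
  simp only [chi, ContinuousAlternatingMap.neg_apply, inner_neg_left,
    ContinuousAlternatingMap.sum_apply, sum_inner, ContinuousAlternatingMap.smulRight_apply,
    real_inner_smul_left]
  congr 1
  refine Finset.sum_congr rfl fun i _ => ?_
  simp [stdVec, EuclideanSpace.inner_single_left, mul_comm]

/-- The octonionic cross product on `ℝ⁷`: `⟨x × y, z⟩ = φ(x,y,z)`. -/
def cross (x y : R7) : R7 := ∑ i : Fin 7, phi ![x, y, stdVec i] • stdVec i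

/-- The defining property of the cross product. -/
theorem inner_cross (x y z : R7) : inner ℝ (cross x y) z = phi ![x, y, z] := by
  have h (u : R7) : phi ![x, y, u] = ((phi.curryLeft x).curryLeft y).curryLeft u ![] := rfl
  have h2 : phi ![x, y, z] = ∑ i : Fin 7, z i * phi ![x, y, stdVec i] := by
    simp only [h]
    conv_lhs => rw [← sum_coord_smul_stdVec z]
    simp only [map_sum, map_smul, ContinuousAlternatingMap.sum_apply,
      ContinuousAlternatingMap.smul_apply, smul_eq_mul]
  rw [h2]
  simp only [cross, sum_inner, real_inner_smul_left]
  refine Finset.sum_congr rfl fun i _ => ?_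
  simp [stdVec, EuclideanSpace.inner_single_left, mul_comm]

theorem cross_add (x y z : R7) : cross x (y + z) = cross x y + cross x z := by
  have h : ∀ w u : R7, phi ![x, w, u] = (phi.curryLeft x).curryLeft w ![u] := fun _ _ => rfl
  simp only [cross, h, map_add, ContinuousAlternatingMap.add_apply, add_smul,
    Finset.sum_add_distrib]

theorem cross_smul (c : ℝ) (x y : R7) : cross x (c • y) = c • cross x y := by
  have h : ∀ w u : R7, phi ![x, w, u] = (phi.curryLeft x).curryLeft w ![u] := fun _ _ => rfl
  simp only [cross, h, map_smul, ContinuousAlternatingMap.smul_apply, smul_assoc,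
    Finset.smul_sum]

/-- The unit sphere `𝒮⁶` in `ℝ⁷`. -/
abbrev S6 : Set R7 := Metric.sphere 0 1

/-- The almost complex structure of `𝒮⁶`: `J_σ u = σ × u` for `u ∈ T_σ 𝒮⁶`. -/
def J (σ u : R7) : R7 := cross σ u

/-- The 2-form `ω` on `𝒮⁶`: `ω_σ(u,w) = ⟨J_σ u, w⟩ = φ(σ,u,w)`. -/
def omega (σ : R7) : R7 [⋀^Fin 2]→L[ℝ] ℝ := phi.curryLeft σ

/-- The 2-form `ζ` on `𝒮⁶` with values in `Tℝ⁷|_{𝒮⁶}` that occurs in the splitting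
`χ = r² ξ + r dr ∧ ζ`, i.e. the contraction of `χ` with the radial vector `∂/∂r = σ` at `σ ∈ 𝒮⁶`. -/
def zeta (σ : R7) : R7 [⋀^Fin 2]→L[ℝ] R7 := chi.curryLeft σ

/-! ### Submanifolds, normal bundles, and the derivative of normal-bundle-valued forms -/

/-- `P` is a smooth embedded `k`-dimensional submanifold (without boundary) of `ℝ⁷`: around each of
its points there is a smooth chart of `ℝ⁷` in which `P` is the slice where the coordinates with
index `≥ k` vanish. -/
def IsSmoothSubmanifold (k : ℕ) (P : Set R7) : Prop :=
  ∀ x ∈ P, ∃ Φ : OpenPartialHomeomorph R7 R7, x ∈ Φ.source ∧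
    ContDiffOn ℝ ∞ Φ Φ.source ∧ ContDiffOn ℝ ∞ Φ.symm Φ.target ∧
    ∀ y ∈ Φ.source, (y ∈ P ↔ ∀ i : Fin 7, k ≤ i.val → Φ y i = 0)

/-- The tangent space `T_x P` as a linear subspace of `ℝ⁷`. -/
def tangent (P : Set R7) (x : R7) : Submodule ℝ R7 := Submodule.span ℝ (tangentConeAt ℝ P x)

/-- The fibre `ν_x(P)` of the normal bundle of `P` in `M`, where `P ⊆ M ⊆ ℝ⁷`: the orthogonal
complement of `T_x P` in `T_x M`. -/
def normalSpace (M P : Set R7) (x : R7) : Submodule ℝ R7 := tangent M x ⊓ (tangent P x)ᗮ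

/-- The space `C^∞(ν(P))` of smooth sections of the normal bundle of `P` in `M`. A section is
represented by the map `ℝ⁷ → ℝ⁷` that vanishes off `P`, so that it is determined by its values
on `P`. -/
def normalSections (M P : Set R7) : Submodule ℝ (R7 → R7) where
  carrier := {v | ContDiffOn ℝ ∞ v P ∧ (∀ x ∈ P, v x ∈ normalSpace M P x) ∧ ∀ x ∉ P, v x = 0}
  zero_mem' := ⟨contDiffOn_const, fun _ _ => Submodule.zero_mem _, fun _ _ => rfl⟩
  add_mem' := fun hv hw => ⟨hv.1.add hw.1, fun x hx => Submodule.add_mem _ (hv.2.1 x hx)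
    (hw.2.1 x hx), fun x hx => by simp [hv.2.2 x hx, hw.2.2 x hx]⟩
  smul_mem' := fun c v hv => ⟨contDiffOn_const.smul hv.1, fun x hx => Submodule.smul_mem _ c
    (hv.2.1 x hx), fun x hx => by simp [hv.2.2 x hx]⟩

/-- The derivative `d^⊥_P η`, at `x`, of a `ν(P)`-valued `m`-form `η` on `P ⊆ M`, for the connection
on `ν(P)` induced by the Levi-Civita connection of `M ⊆ ℝ⁷`, i.e. differentiation in `ℝ⁷` followed
by orthogonal projection to `ν(P)`. The form on `P` is given by a family, smooth along `P`, of
alternating maps on `ℝ⁷`, of which only the restrictions to `T P` matter; the result is meant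
on vectors of `T_x P`, where it does not depend on the choices (`extDerivWithin` differentiates
along `P` only). -/
def normalExtDeriv (M P : Set R7) {m : ℕ} (η : R7 → R7 [⋀^Fin m]→L[ℝ] R7) (x : R7) :
    R7 [⋀^Fin (m + 1)]→L[ℝ] R7 :=
  (normalSpace M P x).starProjection.compContinuousAlternatingMap (extDerivWithin η P x)

open Classical in
/-- The Hodge star of a form `α` of top degree `k` on the `k`-dimensional Euclidean space `T`,
oriented by the `k`-form `vol`: the value of `α` on an oriented orthonormal basis of `T`. -/
def hodgeTop {k : ℕ} (T : Submodule ℝ R7) (vol : R7 [⋀^Fin k]→L[ℝ] ℝ)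
    (α : R7 [⋀^Fin k]→L[ℝ] R7) : R7 :=
  if h : ∃ e : Fin k → R7, Orthonormal ℝ e ∧ (∀ i, e i ∈ T) ∧ 0 < vol e then α h.choose else 0

/-! ### Associative 3-folds, cones, and the operators -/

/-- `N` is an associative 3-fold: a 3-dimensional submanifold with `φ|_{T_x N} = vol_{T_x N}` for a
suitable orientation (which is then the one given by the nowhere vanishing form `φ|_N`). -/
def IsAssociative (N : Set R7) : Prop :=
  IsSmoothSubmanifold 3 N ∧
    ∀ x ∈ N, ∃ e : Fin 3 → R7, Orthonormal ℝ e ∧ (∀ i, e i ∈ tangent N x) ∧ phi e = 1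

/-- The cone `{rσ : r > 0, σ ∈ L}` with link `L ⊆ 𝒮⁶`. -/
def coneOver (L : Set R7) : Set R7 := {x | ∃ r : ℝ, 0 < r ∧ ∃ σ ∈ L, x = r • σ}

/-- The operator `v ↦ *d^⊥_N (v·χ)|_N` on normal vector fields of an associative 3-fold `N ⊆ ℝ⁷`,
with `N` oriented by `φ|_N`. -/
def diracAssoc (N : Set R7) (v : R7 → R7) (x : R7) : R7 :=
  hodgeTop (tangent N x) phi (normalExtDeriv univ N (fun y => chi.curryLeft (v y)) x)

/-- The operator `v ↦ *d^⊥_Σ (v·ζ)|_Σ` on normal vector fields of the link `Σ = L` in `𝒮⁶`, with `L`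
oriented by `ω|_L`. -/
def diracLink (L : Set R7) (v : R7 → R7) (σ : R7) : R7 :=
  hodgeTop (tangent L σ) (omega σ) (normalExtDeriv S6 L (fun y => (zeta y).curryLeft (v y)) σ)

/-- The operator `∂̄_Σ = J ∘ D_Σ` on normal vector fields of the link `Σ = L` in `𝒮⁶`. -/
def dbarLink (L : Set R7) (v : R7 → R7) (σ : R7) : R7 := J σ (diracLink L v σ)

/-! Linearity of these operators, needed for their kernels to be linear subspaces. -/

theorem fderivWithin_add_tangent {F : Type*} [NormedAddCommGroup F] [NormedSpace ℝ F]
    {P : Set R7} {x u : R7} {f g : R7 → F} (hf : DifferentiableWithinAt ℝ f P x)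
    (hg : DifferentiableWithinAt ℝ g P x) (hu : u ∈ tangent P x) :
    fderivWithin ℝ (fun y => f y + g y) P x u
      = fderivWithin ℝ f P x u + fderivWithin ℝ g P x u := by
  have h := HasFDerivWithinAt.unique_on (hf.add hg).hasFDerivWithinAt
    (hf.hasFDerivWithinAt.add hg.hasFDerivWithinAt)
  exact LinearMap.eqOn_span
    (f := ((fderivWithin ℝ (fun y => f y + g y) P x : R7 →L[ℝ] F) : R7 →ₗ[ℝ] F))
    (g := ((fderivWithin ℝ f P x + fderivWithin ℝ g P x : R7 →L[ℝ] F) : R7 →ₗ[ℝ] F)) h hu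

theorem fderivWithin_smul_tangent {F : Type*} [NormedAddCommGroup F] [NormedSpace ℝ F]
    {P : Set R7} {x u : R7} {f : R7 → F} (c : ℝ) (hf : DifferentiableWithinAt ℝ f P x)
    (hu : u ∈ tangent P x) :
    fderivWithin ℝ (fun y => c • f y) P x u = c • fderivWithin ℝ f P x u := by
  have h := HasFDerivWithinAt.unique_on (hf.const_smul c).hasFDerivWithinAt
    (hf.hasFDerivWithinAt.const_smul c)
  exact LinearMap.eqOn_span
    (f := ((fderivWithin ℝ (fun y => c • f y) P x : R7 →L[ℝ] F) : R7 →ₗ[ℝ] F))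
    (g := ((c • fderivWithin ℝ f P x : R7 →L[ℝ] F) : R7 →ₗ[ℝ] F)) h hu

theorem hodgeTop_normalExtDeriv_add (M P : Set R7) {m : ℕ} (vol : R7 [⋀^Fin (m + 1)]→L[ℝ] ℝ)
    {η θ : R7 → R7 [⋀^Fin m]→L[ℝ] R7} {x : R7} (hη : DifferentiableWithinAt ℝ η P x)
    (hθ : DifferentiableWithinAt ℝ θ P x) :
    hodgeTop (tangent P x) vol (normalExtDeriv M P (fun y => η y + θ y) x)
      = hodgeTop (tangent P x) vol (normalExtDeriv M P η x)
        + hodgeTop (tangent P x) vol (normalExtDeriv M P θ x) := by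
  unfold hodgeTop
  split_ifs with h
  · have hT := h.choose_spec.2.1
    simp only [normalExtDeriv, ContinuousLinearMap.compContinuousAlternatingMap_coe,
      Function.comp_apply, extDerivWithin, ContinuousAlternatingMap.alternatizeUncurryFin_apply,
      fderivWithin_add_tangent hη hθ (hT _), ContinuousAlternatingMap.add_apply, smul_add,
      Finset.sum_add_distrib, map_add]
  · simp

theorem hodgeTop_normalExtDeriv_smul (M P : Set R7) {m : ℕ} (vol : R7 [⋀^Fin (m + 1)]→L[ℝ] ℝ)
    {η : R7 → R7 [⋀^Fin m]→L[ℝ] R7} {x : R7} (c : ℝ) (hη : DifferentiableWithinAt ℝ η P x) :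
    hodgeTop (tangent P x) vol (normalExtDeriv M P (fun y => c • η y) x)
      = c • hodgeTop (tangent P x) vol (normalExtDeriv M P η x) := by
  unfold hodgeTop
  split_ifs with h
  · have hT := h.choose_spec.2.1
    simp only [normalExtDeriv, ContinuousLinearMap.compContinuousAlternatingMap_coe,
      Function.comp_apply, extDerivWithin, ContinuousAlternatingMap.alternatizeUncurryFin_apply,
      fderivWithin_smul_tangent c hη (hT _), ContinuousAlternatingMap.smul_apply]
    rw [← map_smul, Finset.smul_sum]
    congr 1
    exact Finset.sum_congr rfl fun i _ => smul_comm _ _ _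
  · simp

theorem differentiable_of_mem {M P : Set R7} {v : R7 → R7} (hv : v ∈ normalSections M P) {x : R7}
    (hx : x ∈ P) : DifferentiableWithinAt ℝ v P x :=
  (hv.1 x hx).differentiableWithinAt (by simp)

theorem differentiable_chi {P : Set R7} {v : R7 → R7} {x : R7}
    (hv : DifferentiableWithinAt ℝ v P x) :
    DifferentiableWithinAt ℝ (fun y => chi.curryLeft (v y)) P x :=
  chi.curryLeft.differentiableAt.comp_differentiableWithinAt x hv

theorem differentiable_zeta {P : Set R7} {v : R7 → R7} {x : R7}
    (hv : DifferentiableWithinAt ℝ v P x) :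
    DifferentiableWithinAt ℝ (fun y => (zeta y).curryLeft (v y)) P x := by
  have h : DifferentiableWithinAt ℝ (fun y => (zeta y).curryLeft) P x := by
    have h1 := (ContinuousAlternatingMap.curryLeftLI (𝕜 := ℝ) (E := R7) (F := R7)
      (n := 1)).toContinuousLinearMap.comp chi.curryLeft
    exact ((ContinuousAlternatingMap.curryLeftLI (𝕜 := ℝ) (E := R7) (F := R7)
      (n := 1)).toContinuousLinearMap.comp chi.curryLeft).differentiableAt.differentiableWithinAt
  exact h.clm_apply hv

theorem diracAssoc_add {N : Set R7} {v w : R7 → R7} {x : R7}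
    (hv : DifferentiableWithinAt ℝ v N x) (hw : DifferentiableWithinAt ℝ w N x) :
    diracAssoc N (v + w) x = diracAssoc N v x + diracAssoc N w x := by
  simpa only [diracAssoc, Pi.add_apply, map_add] using
    hodgeTop_normalExtDeriv_add univ N phi (differentiable_chi hv) (differentiable_chi hw)

theorem diracAssoc_smul {N : Set R7} {v : R7 → R7} {x : R7} (c : ℝ)
    (hv : DifferentiableWithinAt ℝ v N x) :
    diracAssoc N (c • v) x = c • diracAssoc N v x := by
  simpa only [diracAssoc, Pi.smul_apply, map_smul] using
    hodgeTop_normalExtDeriv_smul univ N phi c (differentiable_chi hv)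

theorem diracLink_add {L : Set R7} {v w : R7 → R7} {x : R7}
    (hv : DifferentiableWithinAt ℝ v L x) (hw : DifferentiableWithinAt ℝ w L x) :
    diracLink L (v + w) x = diracLink L v x + diracLink L w x := by
  simpa only [diracLink, Pi.add_apply, map_add] using
    hodgeTop_normalExtDeriv_add S6 L (omega x) (differentiable_zeta hv) (differentiable_zeta hw)

theorem diracLink_smul {L : Set R7} {v : R7 → R7} {x : R7} (c : ℝ)
    (hv : DifferentiableWithinAt ℝ v L x) :
    diracLink L (c • v) x = c • diracLink L v x := by
  simpa only [diracLink, Pi.smul_apply, map_smul] using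
    hodgeTop_normalExtDeriv_smul S6 L (omega x) c (differentiable_zeta hv)

/-! ### The spaces whose dimensions are compared -/

/-- `D(μ)`: the smooth normal vector fields `v` of the link in `𝒮⁶` with `∂̄_Σ v = (μ + 1) v`. -/
def eigenspaceD (L : Set R7) (μ : ℝ) : Submodule ℝ (R7 → R7) where
  carrier := {v | v ∈ normalSections S6 L ∧ ∀ σ ∈ L, dbarLink L v σ = (μ + 1) • v σ}
  zero_mem' := by
    refine ⟨Submodule.zero_mem _, fun σ hσ => ?_⟩
    have h := diracLink_smul (L := L) (v := 0) (x := σ) 0 (differentiableWithinAt_const 0)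
    rw [zero_smul, zero_smul] at h
    have h2 := cross_smul 0 σ 0
    simp only [zero_smul] at h2
    simp [dbarLink, J, h, h2]
  add_mem' := by
    intro v w hv hw
    refine ⟨Submodule.add_mem _ hv.1 hw.1, fun σ hσ => ?_⟩
    have h1 := hv.2 σ hσ
    have h2 := hw.2 σ hσ
    simp only [dbarLink, J] at h1 h2 ⊢
    rw [diracLink_add (differentiable_of_mem hv.1 hσ) (differentiable_of_mem hw.1 hσ),
      cross_add, h1, h2, Pi.add_apply, smul_add]
  smul_mem' := by
    intro c v hv
    refine ⟨Submodule.smul_mem _ c hv.1, fun σ hσ => ?_⟩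
    have h1 := hv.2 σ hσ
    simp only [dbarLink, J] at h1 ⊢
    rw [diracLink_smul c (differentiable_of_mem hv.1 hσ), cross_smul, h1, Pi.smul_apply,
      smul_comm]

/-- The finitely supported family `a = (v_j)` of smooth normal vector fields of the link is the
family of coefficients of an expansion
`v(rσ) = r^{μ-1} ∑_j (log r)^j v_j(σ)` for all `r > 0` and `σ` in the link.
Here `ν_{rσ}(C)` and `ν_σ(Σ)` are the same subspace of `ℝ⁷`. -/
def HasLogExpansion (L : Set R7) (μ : ℝ) (v : R7 → R7) (a : ℕ →₀ normalSections S6 L) : Prop :=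
  ∀ r : ℝ, 0 < r → ∀ σ ∈ L,
    v (r • σ) = r ^ (μ - 1) • a.sum fun j w => Real.log r ^ j • (w : R7 → R7) σ

/-- The space, of dimension `d(μ)`, of the normal vector fields `v` of the cone `C` over `L` that solve
`D_C v = 0` and have the form `v(rσ) = r^{μ-1} v_Σ(r,σ)`, with `v_Σ(r,σ)` a polynomial in `log r`
with coefficients in `C^∞(ν(Σ))`. -/
def logSolutions (L : Set R7) (μ : ℝ) : Submodule ℝ (R7 → R7) where
  carrier := {v | v ∈ normalSections univ (coneOver L) ∧ (∃ a, HasLogExpansion L μ v a) ∧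
    ∀ x ∈ coneOver L, diracAssoc (coneOver L) v x = 0}
  zero_mem' := by
    refine ⟨Submodule.zero_mem _, ⟨0, fun r _ σ _ => by simp⟩, fun x _ => ?_⟩
    have h := diracAssoc_smul (N := coneOver L) (v := 0) (x := x) 0
      (differentiableWithinAt_const 0)
    rwa [zero_smul, zero_smul] at h
  add_mem' := by
    rintro v w ⟨hv, ⟨a, ha⟩, hv0⟩ ⟨hw, ⟨b, hb⟩, hw0⟩
    refine ⟨Submodule.add_mem _ hv hw, ⟨a + b, fun r hr σ hσ => ?_⟩, fun x hx => ?_⟩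
    · rw [Pi.add_apply, ha r hr σ hσ, hb r hr σ hσ, ← smul_add,
        Finsupp.sum_add_index' (by simp) (by simp [smul_add])]
    · rw [diracAssoc_add (differentiable_of_mem hv hx) (differentiable_of_mem hw hx),
        hv0 x hx, hw0 x hx, add_zero]
  smul_mem' := by
    rintro c v ⟨hv, ⟨a, ha⟩, hv0⟩
    refine ⟨Submodule.smul_mem _ c hv, ⟨c • a, fun r hr σ hσ => ?_⟩, fun x hx => ?_⟩
    · rw [Pi.smul_apply, ha r hr σ hσ, Finsupp.sum_smul_index' (by simp), smul_comm c]
      congr 1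
      rw [Finsupp.smul_sum]
      refine Finset.sum_congr rfl fun j _ => ?_
      simp [smul_comm c]
    · rw [diracAssoc_smul c (differentiable_of_mem hv hx), hv0 x hx, smul_zero]

end AssocCone

end

namespace AssocCone

open MeasureTheory

/-! Fix `σ` in the link and an oriented orthonormal frame `σ, a, b` of the associative tangent plane
of the cone, so that `σ × a = b`. If `v` restricts to `c V` on the slice of radius `r`, then at `rσ`
one has `D_C v = J ∂_r v + (c/r) Q`, where `Q` is the normal projection of `χ(σ, ∇_a V, b) - χ(σ,
∇_b V, a)`. On the link, `∂̄ V = J Q + 2 V`; the shift by `2` comes from differentiating the base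
point in `ζ_σ = χ(σ, ·, ·)` (`dbarLink_eq_add`). As `J² = -1` on vectors orthogonal to `σ`, the
equation `D_C v = 0` becomes the radial equation `r ∂_r v = (∂̄ - 2) v`
(`diracAssoc_coneOver_eq_zero_iff`). Inserting the expansion and comparing powers of `log r` gives
`∂̄ v_j = (μ + 1) v_j + (j + 1) v_{j+1}` (`dbarLink_coeff`).

This is a Jordan chain of `∂̄` for the eigenvalue `μ + 1`, and a symmetric operator has no Jordan
chain of length greater than one: if `v_{j+2} = 0`, then pairing `∂̄ v_j` with `v_{j+1}` in `L²` and
moving `∂̄` across leaves `(j + 1) ∫ |v_{j+1}|² = 0` (`coeff_eq_zero`). Symmetry holds because the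
pointwise defect `⟨∂̄v, w⟩ - ⟨v, ∂̄w⟩`, times the area form, is an exact 2-form
(`dbarLink_pairing`). Its integral over the compact link vanishes by Stokes' theorem, carried out
with local parametrizations and a partition of unity (`eq_zero_of_asymmetry_eq_mul_norm_sq`).

Conversely, an eigenfield extends homogeneously of degree `μ - 1` to a solution on the cone. With
the absence of logarithms this gives a linear isomorphism between the two spaces
(`homogeneousExtLinear_bijective`). -/

/-! ### Algebra of `φ`, `χ` and the cross product -/

theorem phi_apply (x y z : R7) : phi ![x, y, z] =
    (x 1 * y 2 * z 3 - x 1 * y 3 * z 2 - x 2 * y 1 * z 3 + x 2 * y 3 * z 1 + x 3 * y 1 * z 2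
      - x 3 * y 2 * z 1)
    + (x 1 * y 4 * z 5 - x 1 * y 5 * z 4 - x 4 * y 1 * z 5 + x 4 * y 5 * z 1 + x 5 * y 1 * z 4
      - x 5 * y 4 * z 1)
    + (x 1 * y 6 * z 0 - x 1 * y 0 * z 6 - x 6 * y 1 * z 0 + x 6 * y 0 * z 1 + x 0 * y 1 * z 6
      - x 0 * y 6 * z 1)
    + (x 2 * y 4 * z 6 - x 2 * y 6 * z 4 - x 4 * y 2 * z 6 + x 4 * y 6 * z 2 + x 6 * y 2 * z 4
      - x 6 * y 4 * z 2)
    - (x 2 * y 5 * z 0 - x 2 * y 0 * z 5 - x 5 * y 2 * z 0 + x 5 * y 0 * z 2 + x 0 * y 2 * z 5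
      - x 0 * y 5 * z 2)
    - (x 3 * y 4 * z 0 - x 3 * y 0 * z 4 - x 4 * y 3 * z 0 + x 4 * y 0 * z 3 + x 0 * y 3 * z 4
      - x 0 * y 4 * z 3)
    - (x 3 * y 5 * z 6 - x 3 * y 6 * z 5 - x 5 * y 3 * z 6 + x 5 * y 6 * z 3 + x 6 * y 3 * z 5
      - x 6 * y 5 * z 3) := by
  simp only [phi, ContinuousAlternatingMap.add_apply, ContinuousAlternatingMap.sub_apply, dx_apply,
    Matrix.det_fin_three, Matrix.of_apply]
  simp only [Matrix.cons_val]
  norm_num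
  rfl

theorem cross_apply (x y : R7) (i : Fin 7) : cross x y i = phi ![x, y, stdVec i] := by
  rw [← inner_cross]
  simp [stdVec, EuclideanSpace.inner_single_right]

theorem inner_R7 (x y : R7) : inner ℝ x y =
    x 0 * y 0 + x 1 * y 1 + x 2 * y 2 + x 3 * y 3 + x 4 * y 4 + x 5 * y 5 + x 6 * y 6 := by
  simp [PiLp.inner_apply, Fin.sum_univ_seven, mul_comm]

theorem chi_apply (x y z : R7) (i : Fin 7) : chi ![x, y, z] i = starPhi ![x, y, z, stdVec i] := by
  rw [← inner_chi]
  simp [stdVec, EuclideanSpace.inner_single_right]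

theorem det_fin_four (A : Matrix (Fin 4) (Fin 4) ℝ) : A.det =
    A 3 3 * (A 0 0 * (A 1 1 * A 2 2 - A 1 2 * A 2 1) - A 0 1 * (A 1 0 * A 2 2 - A 1 2 * A 2 0)
        + A 0 2 * (A 1 0 * A 2 1 - A 1 1 * A 2 0))
    - A 3 2 * (A 0 0 * (A 1 1 * A 2 3 - A 1 3 * A 2 1) - A 0 1 * (A 1 0 * A 2 3 - A 1 3 * A 2 0)
        + A 0 3 * (A 1 0 * A 2 1 - A 1 1 * A 2 0))
    + A 3 1 * (A 0 0 * (A 1 2 * A 2 3 - A 1 3 * A 2 2) - A 0 2 * (A 1 0 * A 2 3 - A 1 3 * A 2 0)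
        + A 0 3 * (A 1 0 * A 2 2 - A 1 2 * A 2 0))
    - A 3 0 * (A 0 1 * (A 1 2 * A 2 3 - A 1 3 * A 2 2) - A 0 2 * (A 1 1 * A 2 3 - A 1 3 * A 2 1)
        + A 0 3 * (A 1 1 * A 2 2 - A 1 2 * A 2 1)) := by
  rw [Matrix.det_succ_row _ 3, Fin.sum_univ_four]
  simp only [Matrix.det_fin_three, Matrix.submatrix_apply]
  simp [Fin.succAbove, Fin.lt_def]
  ring

theorem dx_vec_four (a b c d : Fin 7) (x y z w : R7) : dx ![a, b, c, d] ![x, y, z, w] =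
    w d * (x a * (y b * z c - y c * z b) - x b * (y a * z c - y c * z a)
        + x c * (y a * z b - y b * z a))
    - w c * (x a * (y b * z d - y d * z b) - x b * (y a * z d - y d * z a)
        + x d * (y a * z b - y b * z a))
    + w b * (x a * (y c * z d - y d * z c) - x c * (y a * z d - y d * z a)
        + x d * (y a * z c - y c * z a))
    - w a * (x b * (y c * z d - y d * z c) - x c * (y b * z d - y d * z b)
        + x d * (y b * z c - y c * z b)) := by
  rw [dx_apply, det_fin_four]
  rfl

theorem stdVec_apply (i j : Fin 7) : stdVec i j = if j = i then 1 else 0 := by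
  simp [stdVec]

/-- This reduces every later computation with `χ` to cross products. Both sides are explicit cubic
polynomials in the coordinates, and they are compared one component at a time. -/
theorem chi_eq (x y z : R7) :
    chi ![x, y, z] = -cross x (cross y z) - inner ℝ x y • z + inner ℝ x z • y := by
  ext i
  rw [chi_apply]
  simp only [PiLp.add_apply, PiLp.sub_apply, PiLp.neg_apply, PiLp.smul_apply, smul_eq_mul,
    cross_apply, inner_R7, phi_apply, starPhi, ContinuousAlternatingMap.add_apply,
    ContinuousAlternatingMap.sub_apply, dx_vec_four, stdVec_apply]
  fin_cases i <;>
  · simp +decide only [if_true, if_false, mul_zero, mul_one, zero_mul, add_zero, zero_add,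
      sub_zero, zero_sub, Fin.zero_eta, Fin.mk_one, Fin.reduceFinMk, show (7 : Fin 7) = 0 from rfl]
    ring

theorem phi_swap_left (x y z : R7) : phi ![y, x, z] = -phi ![x, y, z] := by
  simp only [phi_apply]; ring

theorem phi_swap_right (x y z : R7) : phi ![x, z, y] = -phi ![x, y, z] := by
  simp only [phi_apply]; ring

theorem phi_cycle (x y z : R7) : phi ![y, z, x] = phi ![x, y, z] := by
  simp only [phi_apply]; ring

theorem phi_self_right (x y : R7) : phi ![x, y, y] = 0 := by
  simp only [phi_apply]; ring

theorem phi_self_outer (x y : R7) : phi ![x, y, x] = 0 := by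
  simp only [phi_apply]; ring

theorem cross_swap (x y : R7) : cross y x = -cross x y := by
  ext i
  simp only [cross_apply, PiLp.neg_apply, phi_swap_left x y]

theorem cross_neg (x y : R7) : cross x (-y) = -cross x y := by
  simpa using cross_smul (-1) x y

theorem cross_zero (x : R7) : cross x 0 = 0 := by
  simpa using cross_smul 0 x 0

theorem cross_smul_left (c : ℝ) (x y : R7) : cross (c • x) y = c • cross x y := by
  rw [cross_swap, cross_smul, cross_swap x y, smul_neg, neg_neg]

theorem inner_cross_left (x y : R7) : inner ℝ x (cross x y) = 0 := by
  rw [real_inner_comm, inner_cross, phi_self_outer]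

theorem chi_cycle (x y z : R7) : chi ![y, z, x] = chi ![x, y, z] := by
  have h (f : R7 [⋀^Fin 3]→L[ℝ] R7) : f ![y, z, x] = f ![x, y, z] := by
    have h4 := f.toAlternatingMap.map_perm ![x, y, z] (finRotate 3)
    have h5 : (![x, y, z] ∘ (finRotate 3) : Fin 3 → R7) = ![y, z, x] := by
      funext i
      fin_cases i <;> rfl
    rw [h5] at h4
    simpa [sign_finRotate] using h4
  exact h chi

theorem chi_swap_left (x y z : R7) : chi ![y, x, z] = -chi ![x, y, z] := by
  have h (f : R7 [⋀^Fin 3]→L[ℝ] R7) : f ![y, x, z] = -f ![x, y, z] := by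
    have h4 := f.toAlternatingMap.map_swap ![x, y, z] (show (0 : Fin 3) ≠ 1 by decide)
    have h5 : (![x, y, z] ∘ (Equiv.swap (0 : Fin 3) 1) : Fin 3 → R7) = ![y, x, z] := by
      funext i
      fin_cases i <;> rfl
    rw [h5] at h4
    simpa using h4
  exact h chi

/-- Put a repeated argument into `chi_eq`: the alternating left side vanishes. For a unit vector `x`
this says `J² = -1` on the orthogonal complement of `x`. -/
theorem cross_cross_self (x y : R7) :
    cross x (cross x y) = inner ℝ x y • x - inner ℝ x x • y := by
  have h := chi_eq x x y
  have h0 : chi ![x, x, y] = 0 := by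
    have h2 := add_eq_zero_iff_eq_neg.2 (chi_swap_left x x y)
    rw [← two_smul ℝ] at h2
    exact (smul_eq_zero.1 h2).resolve_left two_ne_zero
  rw [h0] at h
  have h1 : cross x (cross x y) = cross x (cross x y) + 0 := by rw [add_zero]
  rw [h1, h]
  abel

theorem inner_cross_self (x y : R7) :
    inner ℝ (cross x y) (cross x y) = inner ℝ x x * inner ℝ y y - inner ℝ x y ^ 2 := by
  rw [inner_cross, phi_swap_right, ← inner_cross, cross_cross_self]
  simp only [inner_sub_left, real_inner_smul_left]
  ring

/-- An oriented orthonormal basis `σ, a, b` of an associative 3-plane. -/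
structure AssocFrame (σ a b : R7) : Prop where
  norm_fst : inner ℝ σ σ = 1
  norm_snd : inner ℝ a a = 1
  norm_trd : inner ℝ b b = 1
  fst_snd : inner ℝ σ a = 0
  fst_trd : inner ℝ σ b = 0
  snd_trd : inner ℝ a b = 0
  phi_eq : phi ![σ, a, b] = 1

/-- The equality case of the calibration inequality: `|x × y|² = 1 - ⟨x, y⟩² ≤ 1` and `⟨x × y, z⟩ =
1` force `|x × y - z|² ≤ 0`. -/
theorem cross_eq_of_phi_eq_one {x y z : R7} (hx : inner ℝ x x = 1) (hy : inner ℝ y y = 1)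
    (hz : inner ℝ z z = 1) (h : phi ![x, y, z] = 1) : cross x y = z := by
  have h1 := inner_cross_self x y
  rw [← inner_cross] at h
  have h2 : inner ℝ (cross x y - z) (cross x y - z) ≤ 0 := by
    simp only [inner_sub_left, inner_sub_right, real_inner_comm (cross x y) z, h, h1, hx, hy, hz]
    nlinarith [sq_nonneg (inner ℝ x y)]
  exact sub_eq_zero.1 (inner_self_eq_zero.1 (le_antisymm h2 real_inner_self_nonneg))

namespace AssocFrame

variable {σ a b : R7}

theorem cross_fst_snd (h : AssocFrame σ a b) : cross σ a = b :=
  cross_eq_of_phi_eq_one h.norm_fst h.norm_snd h.norm_trd h.phi_eq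

theorem cross_snd_trd (h : AssocFrame σ a b) : cross a b = σ :=
  cross_eq_of_phi_eq_one h.norm_snd h.norm_trd h.norm_fst (by rw [phi_cycle, h.phi_eq])

theorem cross_trd_fst (h : AssocFrame σ a b) : cross b σ = a :=
  cross_eq_of_phi_eq_one h.norm_trd h.norm_fst h.norm_snd (by rw [phi_cycle, phi_cycle, h.phi_eq])

theorem chi_fst (h : AssocFrame σ a b) {v : R7} (ha : inner ℝ a v = 0) (hb : inner ℝ b v = 0) :
    chi ![v, a, b] = cross σ v := by
  rw [chi_eq, h.cross_snd_trd, real_inner_comm, ha, real_inner_comm, hb, cross_swap σ v]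
  simp

/-- `J` is skew and exchanges `a` and `b` up to sign, so it preserves the orthogonal complement of
the plane they span. -/
theorem inner_cross_fst (h : AssocFrame σ a b) {n : R7} (ha : inner ℝ a n = 0)
    (hb : inner ℝ b n = 0) :
    inner ℝ σ (cross σ n) = 0 ∧ inner ℝ a (cross σ n) = 0 ∧ inner ℝ b (cross σ n) = 0 := by
  refine ⟨inner_cross_left _ _, ?_, ?_⟩
  · rw [real_inner_comm, inner_cross, phi_swap_right, ← inner_cross, h.cross_fst_snd, hb, neg_zero]
  · rw [real_inner_comm, inner_cross, ← phi_cycle, ← phi_cycle, ← inner_cross, h.cross_trd_fst, ha]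

/-- The arguments are rotated so that `chi_eq` has the product `b × σ = a` of two frame vectors
inside; the remaining terms are orthogonal to `n`. -/
theorem inner_chi_fst_trd (h : AssocFrame σ a b) {n : R7} (w : R7) (hσ : inner ℝ σ n = 0)
    (hb : inner ℝ b n = 0) : inner ℝ (chi ![σ, w, b]) n = phi ![a, w, n] := by
  rw [← chi_cycle, chi_eq, h.cross_trd_fst]
  simp only [inner_add_left, inner_sub_left, inner_neg_left, real_inner_smul_left, hσ, hb,
    inner_cross, phi_swap_left a w]
  ring

theorem inner_chi_fst_snd (h : AssocFrame σ a b) {n : R7} (w : R7) (hσ : inner ℝ σ n = 0)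
    (ha : inner ℝ a n = 0) : inner ℝ (chi ![σ, w, a]) n = -phi ![b, w, n] := by
  rw [← chi_cycle, chi_eq, cross_swap σ a, h.cross_fst_snd]
  simp only [inner_add_left, inner_sub_left, inner_neg_left, real_inner_smul_left, hσ, ha,
    inner_cross, cross_neg, phi_swap_left b w]
  ring

/-- Evaluating `χ(a, σ, n) = χ(n, a, σ)` on both sides with `chi_eq` gives `a × (σ × n) = b × n`.
This removes `J` from a normal vector at the cost of turning `a` into `b`. -/
theorem phi_snd_cross (h : AssocFrame σ a b) {n : R7} (w : R7) (hσ : inner ℝ σ n = 0)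
    (ha : inner ℝ a n = 0) : phi ![a, w, cross σ n] = -phi ![b, n, w] := by
  have h1 : chi ![a, σ, n] = chi ![n, a, σ] := (chi_cycle _ _ _)
  rw [chi_eq, chi_eq, cross_swap σ a, h.cross_fst_snd, real_inner_comm, h.fst_snd, ha,
    real_inner_comm, ha, real_inner_comm σ n, hσ, cross_neg, cross_swap b n] at h1
  have h2 : cross a (cross σ n) = cross b n := by simpa using h1
  rw [phi_swap_right, ← inner_cross, h2, inner_cross]

theorem phi_trd_cross (h : AssocFrame σ a b) {n : R7} (w : R7) (hσ : inner ℝ σ n = 0)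
    (hb : inner ℝ b n = 0) : phi ![b, w, cross σ n] = phi ![a, n, w] := by
  have h1 : chi ![b, σ, n] = chi ![n, b, σ] := (chi_cycle _ _ _)
  rw [chi_eq, chi_eq, h.cross_trd_fst, real_inner_comm, h.fst_trd, hb,
    real_inner_comm, hb, real_inner_comm σ n, hσ, cross_swap a n] at h1
  have h2 : cross b (cross σ n) = -cross a n := by simpa [neg_eq_iff_eq_neg] using h1
  rw [phi_swap_right, ← inner_cross, h2, inner_neg_left, inner_cross, neg_neg]

end AssocFrame

/-! ### Tangent spaces of the link, the sphere and the cone -/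

theorem mem_tangent_of_hasFDerivWithinAt {E : Type*} [NormedAddCommGroup E] [NormedSpace ℝ E]
    {f : E → R7} {f' : E →L[ℝ] R7} {P : Set E} {Q : Set R7} {x : E}
    (h : HasFDerivWithinAt f f' P x) (hm : MapsTo f P Q) {u : E}
    (hu : u ∈ Submodule.span ℝ (tangentConeAt ℝ P x)) : f' u ∈ tangent Q (f x) := by
  induction hu using Submodule.span_induction with
  | mem u hu =>
    exact Submodule.subset_span (tangentConeAt_mono hm.image_subset (h.mapsTo_tangent_cone hu))
  | zero => simp
  | add u w _ _ hu hw => rw [map_add]; exact add_mem hu hw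
  | smul c u _ hu => rw [map_smul]; exact Submodule.smul_mem _ c hu

/-- A derivative along `P` is determined on the tangent cone only, hence by linearity on its span.
This stands in for unique differentiability, which fails for submanifolds of positive codimension.
-/
theorem hasFDerivWithinAt_unique_tangent {F : Type*} [NormedAddCommGroup F] [NormedSpace ℝ F]
    {f : R7 → F} {f' g' : R7 →L[ℝ] F} {P : Set R7} {x u : R7}
    (hf : HasFDerivWithinAt f f' P x) (hg : HasFDerivWithinAt f g' P x) (hu : u ∈ tangent P x) :
    f' u = g' u :=
  LinearMap.eqOn_span (f := (f' : R7 →ₗ[ℝ] F)) (g := (g' : R7 →ₗ[ℝ] F)) (hf.unique_on hg) hu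

theorem tangentConeAt_eq_univ_of_mem_nhds {E : Type*} [NormedAddCommGroup E] [NormedSpace ℝ E]
    {s : Set E} {x : E} (h : s ∈ nhds x) : tangentConeAt ℝ s x = univ := by
  simpa using tangentConeAt_inter_nhds (𝕜 := ℝ) (s := univ) h

theorem mem_tangent_of_mem_nhds {E : Type*} [NormedAddCommGroup E] [NormedSpace ℝ E]
    {f : E → R7} {f' : E →L[ℝ] R7} {P : Set E} {Q : Set R7} {x : E}
    (h : HasFDerivWithinAt f f' P x) (hm : MapsTo f P Q) (hP : P ∈ nhds x) (u : E) :
    f' u ∈ tangent Q (f x) := by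
  refine mem_tangent_of_hasFDerivWithinAt h hm ?_
  rw [tangentConeAt_eq_univ_of_mem_nhds hP]
  exact Submodule.subset_span (mem_univ u)

/-- The functional `ℓ` is left unspecified because the radial term is later either shown to vanish
or absorbed into the span of `σ`. -/
theorem hasFDerivAt_normalize {x : R7} (hx : x ≠ 0) :
    ∃ ℓ : R7 →L[ℝ] ℝ, HasFDerivAt (fun y : R7 => ‖y‖⁻¹ • y)
      (‖x‖⁻¹ • ContinuousLinearMap.id ℝ R7 + ℓ.smulRight x) x := by
  have h : DifferentiableAt ℝ (fun y : R7 => ‖y‖⁻¹) x :=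
    (differentiableAt_id.norm ℝ hx).inv (norm_ne_zero_iff.2 hx)
  exact ⟨fderiv ℝ (fun y : R7 => ‖y‖⁻¹) x, h.hasFDerivAt.smul (hasFDerivAt_id x)⟩

theorem inner_eq_zero_of_mem_tangent_sphere {σ u : R7} (hσ : σ ∈ S6) (hu : u ∈ tangent S6 σ) :
    inner ℝ σ u = 0 := by
  have h1 : HasFDerivWithinAt (fun y : R7 => ‖y‖ ^ 2) (2 • innerSL ℝ σ) S6 σ :=
    (hasStrictFDerivAt_norm_sq σ).hasFDerivAt.hasFDerivWithinAt
  have h2 : HasFDerivWithinAt (fun y : R7 => ‖y‖ ^ 2) (0 : R7 →L[ℝ] ℝ) S6 σ :=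
    (hasFDerivWithinAt_const (1 : ℝ) σ S6).congr
      (fun y hy => by simp [mem_sphere_zero_iff_norm.1 hy])
      (by simp [mem_sphere_zero_iff_norm.1 hσ])
  simpa using hasFDerivWithinAt_unique_tangent h1 h2 hu

theorem mem_tangent_sphere {σ u : R7} (hσ : σ ∈ S6) : u ∈ tangent S6 σ ↔ inner ℝ σ u = 0 := by
  refine ⟨inner_eq_zero_of_mem_tangent_sphere hσ, fun hu => ?_⟩
  have hn : ‖σ‖ = 1 := mem_sphere_zero_iff_norm.1 hσ
  have h0 : σ ≠ 0 := by rintro rfl; simp at hn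
  obtain ⟨ℓ, hℓ⟩ := hasFDerivAt_normalize h0
  have h := mem_tangent_of_mem_nhds (P := {0}ᶜ) (Q := S6) hℓ.hasFDerivWithinAt
    (fun y hy => by
      rw [mem_sphere_zero_iff_norm, norm_smul, norm_inv, norm_norm,
        inv_mul_cancel₀ (norm_ne_zero_iff.2 hy)])
    (isOpen_compl_singleton.mem_nhds h0) u
  simp only [hn, inv_one, one_smul] at h
  have h2 := inner_eq_zero_of_mem_tangent_sphere hσ h
  simp only [add_apply, ContinuousLinearMap.id_apply,
    ContinuousLinearMap.smulRight_apply, inner_add_right, hu, real_inner_smul_right,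
    real_inner_self_eq_norm_sq, hn] at h2
  have h3 : ℓ u = 0 := by linarith
  simpa [h3] using h

theorem norm_eq_one_of_mem_link {L : Set R7} (hLS : L ⊆ S6) {σ : R7} (hσ : σ ∈ L) : ‖σ‖ = 1 :=
  mem_sphere_zero_iff_norm.1 (hLS hσ)

theorem mem_coneOver {L : Set R7} {r : ℝ} (hr : 0 < r) {σ : R7} (hσ : σ ∈ L) :
    r • σ ∈ coneOver L := ⟨r, hr, σ, hσ, rfl⟩

/-- For `≤`, differentiate the radial projection of the cone onto the link; its kernel is radial.
For `≥`, differentiate the ray through `σ` and the dilation by `r`. -/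
theorem tangent_coneOver {L : Set R7} (hLS : L ⊆ S6) {r : ℝ} (hr : 0 < r) {σ : R7} (hσ : σ ∈ L) :
    tangent (coneOver L) (r • σ) = Submodule.span ℝ {σ} ⊔ tangent L σ := by
  have hn : ‖σ‖ = 1 := norm_eq_one_of_mem_link hLS hσ
  have h0 : σ ≠ 0 := by rintro rfl; simp at hn
  apply le_antisymm
  · intro u hu
    obtain ⟨ℓ, hℓ⟩ := hasFDerivAt_normalize (smul_ne_zero hr.ne' h0)
    have h := mem_tangent_of_hasFDerivWithinAt (P := coneOver L) (Q := L) hℓ.hasFDerivWithinAt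
      (by
        rintro y ⟨s, hs, τ, hτ, rfl⟩
        have hτ1 := norm_eq_one_of_mem_link hLS hτ
        simpa [norm_smul, hτ1, abs_of_pos hs, smul_smul, hs.ne'] using hτ) hu
    simp only [norm_smul, hn, Real.norm_eq_abs, abs_of_pos hr, mul_one, smul_smul,
      inv_mul_cancel₀ hr.ne', one_smul, add_apply, smul_apply,
      ContinuousLinearMap.id_apply, ContinuousLinearMap.smulRight_apply] at h
    have h2 : u = (-(r * (ℓ u * r))) • σ + r • (r⁻¹ • u + (ℓ u * r) • σ) := by
      rw [smul_add, smul_smul, smul_smul, mul_inv_cancel₀ hr.ne', one_smul]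
      module
    rw [h2]
    exact Submodule.add_mem_sup (Submodule.smul_mem _ _ (Submodule.mem_span_singleton_self σ))
      (Submodule.smul_mem _ _ h)
  · refine sup_le ?_ fun u hu => ?_
    · rw [Submodule.span_singleton_le_iff_mem]
      have h : HasFDerivAt (fun t : ℝ => t • σ)
          ((ContinuousLinearMap.id ℝ ℝ).smulRight σ) r := (hasFDerivAt_id r).smul_const σ
      simpa using mem_tangent_of_mem_nhds (P := Ioi 0) (Q := coneOver L) h.hasFDerivWithinAt
        (fun t ht => mem_coneOver ht hσ) (Ioi_mem_nhds hr) 1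
    · have h : HasFDerivAt (fun y : R7 => r • y) (r • ContinuousLinearMap.id ℝ R7) σ :=
        (hasFDerivAt_id σ).const_smul r
      have h2 := mem_tangent_of_hasFDerivWithinAt (P := L) (Q := coneOver L) h.hasFDerivWithinAt
        (fun y hy => mem_coneOver hr hy) hu
      have h3 := Submodule.smul_mem _ r⁻¹ h2
      simpa [smul_smul, inv_mul_cancel₀ hr.ne'] using h3

theorem tangent_univ (x : R7) : tangent univ x = ⊤ := by
  simp [tangent]

theorem inner_tangent_link {L : Set R7} (hLS : L ⊆ S6) {σ u : R7} (hσ : σ ∈ L)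
    (hu : u ∈ tangent L σ) :
    inner ℝ σ u = 0 :=
  inner_eq_zero_of_mem_tangent_sphere (hLS hσ) (Submodule.span_mono (tangentConeAt_mono hLS) hu)

theorem mem_normalSpace_link {L : Set R7} (hLS : L ⊆ S6) {σ n : R7} (hσ : σ ∈ L) :
    n ∈ normalSpace S6 L σ ↔ inner ℝ σ n = 0 ∧ ∀ u ∈ tangent L σ, inner ℝ u n = 0 := by
  rw [normalSpace, Submodule.mem_inf, mem_tangent_sphere (hLS hσ), Submodule.mem_orthogonal]

theorem normalSpace_coneOver {L : Set R7} (hLS : L ⊆ S6) {r : ℝ} (hr : 0 < r) {σ : R7}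
    (hσ : σ ∈ L) : normalSpace univ (coneOver L) (r • σ) = normalSpace S6 L σ := by
  ext n
  rw [mem_normalSpace_link hLS hσ, normalSpace, tangent_univ, top_inf_eq,
    tangent_coneOver hLS hr hσ, ← Submodule.inf_orthogonal, Submodule.mem_inf,
    Submodule.mem_orthogonal_singleton_iff_inner_right, Submodule.mem_orthogonal]

/-! ### Local parametrizations of a surface -/

/-- A smooth local parametrization `par` of the surface `L`, with connected domain `dom`. Its image
is `L ∩ nbhd`, and the smooth map `coord` on `nbhd` restricts to its inverse. -/
structure LocalParam (L : Set R7) where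
  dom : Set (ℝ × ℝ)
  nbhd : Set R7
  par : ℝ × ℝ → R7
  coord : R7 → ℝ × ℝ
  isOpen_dom : IsOpen dom
  isPreconnected_dom : IsPreconnected dom
  isOpen_nbhd : IsOpen nbhd
  contDiffOn_par : ContDiffOn ℝ ∞ par dom
  contDiffOn_coord : ContDiffOn ℝ ∞ coord nbhd
  par_mem : ∀ p ∈ dom, par p ∈ L
  par_mem_nbhd : ∀ p ∈ dom, par p ∈ nbhd
  coord_mem : ∀ x ∈ L, x ∈ nbhd → coord x ∈ dom
  coord_par : ∀ p ∈ dom, coord (par p) = p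
  par_coord : ∀ x ∈ L, x ∈ nbhd → par (coord x) = x

/-- The slice chart is cut down to a ball in the two free coordinates. The ball keeps the parameter
domain connected, which later fixes the sign of the area coefficient. -/
theorem IsSmoothSubmanifold.exists_localParam {L : Set R7} (hL : IsSmoothSubmanifold 2 L) {x : R7}
    (hx : x ∈ L) : ∃ P : LocalParam L, x ∈ P.nbhd := by
  obtain ⟨Φ, hxΦ, hΦ, hΦs, hmem⟩ := hL x hx
  let ι : ℝ × ℝ →L[ℝ] R7 := (ContinuousLinearMap.fst ℝ ℝ ℝ).smulRight (stdVec 0)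
    + (ContinuousLinearMap.snd ℝ ℝ ℝ).smulRight (stdVec 1)
  let pr : R7 →L[ℝ] ℝ × ℝ := (EuclideanSpace.proj (0 : Fin 7)).prod
    (EuclideanSpace.proj (1 : Fin 7))
  have hpr : ∀ p, pr (ι p) = p := fun p => by
    ext <;> simp [pr, ι, stdVec]
  have hι0 : ∀ p, ∀ i : Fin 7, 2 ≤ i.val → ι p i = 0 := fun p i hi => by
    have h0 : i ≠ 0 := by rintro rfl; simp at hi
    have h1 : i ≠ 1 := by rintro rfl; simp at hi
    simp [ι, stdVec, h0, h1]
  have hιpr : ∀ y : R7, (∀ i : Fin 7, 2 ≤ i.val → y i = 0) → ι (pr y) = y := fun y hy => by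
    ext i
    by_cases h0 : i = 0
    · subst h0; simp [pr, ι, stdVec]
    by_cases h1 : i = 1
    · subst h1; simp [pr, ι, stdVec]
    have : 2 ≤ i.val := by
      by_contra h
      have : i.val = 0 ∨ i.val = 1 := by omega
      rcases this with h | h
      · exact h0 (Fin.ext h)
      · exact h1 (Fin.ext h)
    rw [hι0 _ i this, hy i this]
  have hxι : ι (pr (Φ x)) = Φ x := hιpr _ ((hmem x hxΦ).1 hx)
  have hopen : IsOpen (ι ⁻¹' Φ.target) := Φ.open_target.preimage ι.continuous
  obtain ⟨δ, hδ, hball⟩ := Metric.isOpen_iff.1 hopen (pr (Φ x))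
    (by rw [mem_preimage, hxι]; exact Φ.map_source hxΦ)
  refine ⟨{ dom := Metric.ball (pr (Φ x)) δ
            nbhd := Φ.source ∩ Φ ⁻¹' (pr ⁻¹' Metric.ball (pr (Φ x)) δ)
            par := fun p => Φ.symm (ι p)
            coord := fun y => pr (Φ y)
            isOpen_dom := Metric.isOpen_ball
            isPreconnected_dom := (convex_ball _ _).isPreconnected
            isOpen_nbhd := Φ.isOpen_inter_preimage (Metric.isOpen_ball.preimage pr.continuous)
            contDiffOn_par := hΦs.comp ι.contDiff.contDiffOn hball
            contDiffOn_coord := pr.contDiff.comp_contDiffOn (hΦ.mono inter_subset_left)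
            par_mem := fun p hp => ?_
            par_mem_nbhd := fun p hp => ⟨Φ.map_target (hball hp), ?_⟩
            coord_mem := fun y _ hy => hy.2
            coord_par := fun p hp => ?_
            par_coord := fun y hyL hy => ?_ }, hxΦ, Metric.mem_ball_self hδ⟩
  · rw [hmem _ (Φ.map_target (hball hp)), Φ.right_inv (hball hp)]
    exact hι0 p
  · rw [mem_preimage, mem_preimage, Φ.right_inv (hball hp), hpr]
    exact hp
  · rw [Φ.right_inv (hball hp), hpr]
  · rw [hιpr _ ((hmem y hy.1).1 hyL), Φ.left_inv hy.1]

namespace LocalParam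

variable {L : Set R7} (P : LocalParam L) {p : ℝ × ℝ}

theorem hasFDerivAt_par (hp : p ∈ P.dom) : HasFDerivAt P.par (fderiv ℝ P.par p) p :=
  ((P.contDiffOn_par.contDiffAt (P.isOpen_dom.mem_nhds hp)).differentiableAt
    (by simp)).hasFDerivAt

theorem hasFDerivAt_coord (hp : p ∈ P.dom) :
    HasFDerivAt P.coord (fderiv ℝ P.coord (P.par p)) (P.par p) :=
  ((P.contDiffOn_coord.contDiffAt (P.isOpen_nbhd.mem_nhds (P.par_mem_nbhd p hp))).differentiableAt
    (by simp)).hasFDerivAt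

theorem fderiv_coord_fderiv_par (hp : p ∈ P.dom) (h : ℝ × ℝ) :
    fderiv ℝ P.coord (P.par p) (fderiv ℝ P.par p h) = h := by
  have h1 := (P.hasFDerivAt_coord hp).comp p (P.hasFDerivAt_par hp)
  have h2 : HasFDerivAt (P.coord ∘ P.par) (ContinuousLinearMap.id ℝ (ℝ × ℝ)) p :=
    (hasFDerivAt_id p).congr_of_eventuallyEq
      (Filter.eventually_of_mem (P.isOpen_dom.mem_nhds hp) P.coord_par)
  exact congrArg (fun T : ℝ × ℝ →L[ℝ] ℝ × ℝ => T h) (h1.unique h2)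

theorem fderiv_par_mem_tangent (hp : p ∈ P.dom) (h : ℝ × ℝ) :
    fderiv ℝ P.par p h ∈ tangent L (P.par p) :=
  mem_tangent_of_mem_nhds (P.hasFDerivAt_par hp).hasFDerivWithinAt P.par_mem
    (P.isOpen_dom.mem_nhds hp) h

/-- The composite `par ∘ coord` is the identity on `L` only, so its derivative is the identity on
tangent vectors only. -/
theorem fderiv_par_fderiv_coord (hp : p ∈ P.dom) {u : R7} (hu : u ∈ tangent L (P.par p)) :
    fderiv ℝ P.par p (fderiv ℝ P.coord (P.par p) u) = u := by
  have h0 : HasFDerivAt P.par (fderiv ℝ P.par p) (P.coord (P.par p)) := by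
    rw [P.coord_par p hp]; exact P.hasFDerivAt_par hp
  have h1 := (h0.comp (P.par p) (P.hasFDerivAt_coord hp)).hasFDerivWithinAt (s := L)
  have h2 : HasFDerivWithinAt (P.par ∘ P.coord) (ContinuousLinearMap.id ℝ R7) L (P.par p) :=
    (hasFDerivWithinAt_id (P.par p) L).congr_of_eventuallyEq
      (by
        filter_upwards [self_mem_nhdsWithin,
          mem_nhdsWithin_of_mem_nhds (P.isOpen_nbhd.mem_nhds (P.par_mem_nbhd p hp))] with y hy hy2
        exact P.par_coord y hy hy2)
      (P.par_coord _ (P.par_mem p hp) (P.par_mem_nbhd p hp))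
  exact hasFDerivWithinAt_unique_tangent h1 h2 hu

theorem tangent_eq_span (hp : p ∈ P.dom) : tangent L (P.par p) =
    Submodule.span ℝ {fderiv ℝ P.par p (1, 0), fderiv ℝ P.par p (0, 1)} := by
  apply le_antisymm
  · intro u hu
    rw [Submodule.mem_span_pair, ← P.fderiv_par_fderiv_coord hp hu]
    set h := fderiv ℝ P.coord (P.par p) u
    refine ⟨h.1, h.2, ?_⟩
    rw [← map_smul, ← map_smul, ← map_add]
    congr 1
    ext <;> simp
  · rw [Submodule.span_le]
    rintro _ (rfl | rfl)
    · exact P.fderiv_par_mem_tangent hp _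
    · exact P.fderiv_par_mem_tangent hp _

theorem linearIndependent_fderiv (hp : p ∈ P.dom) :
    LinearIndependent ℝ ![fderiv ℝ P.par p (1, 0), fderiv ℝ P.par p (0, 1)] := by
  rw [LinearIndependent.pair_iff]
  intro s t hst
  rw [← map_smul, ← map_smul, ← map_add] at hst
  have h := P.fderiv_coord_fderiv_par hp (s • (1, 0) + t • (0, 1))
  rw [hst, map_zero] at h
  have h1 := congrArg Prod.fst h
  have h2 := congrArg Prod.snd h
  simp at h1 h2
  exact ⟨h1.symm, h2.symm⟩

end LocalParam

theorem finrank_tangent_link {L : Set R7} (hL : IsSmoothSubmanifold 2 L) {σ : R7} (hσ : σ ∈ L) :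
    Module.finrank ℝ (tangent L σ) = 2 := by
  obtain ⟨P, hP⟩ := hL.exists_localParam hσ
  have hp := P.coord_mem σ hσ hP
  have h1 := P.tangent_eq_span hp
  rw [P.par_coord σ hσ hP] at h1
  rw [h1]
  have h2 := finrank_span_eq_card (P.linearIndependent_fderiv hp)
  rw [Matrix.range_cons, Matrix.range_cons, Matrix.range_empty, union_empty,
    singleton_union] at h2
  simpa using h2

/-! ### Orthonormal frames and the Hodge star -/

/-- Pulled back to `ℝᵏ`, a top-degree alternating form is a multiple of the determinant. -/
theorem map_sum_smul_eq_det_mul {M : Type*} [AddCommGroup M] [Module ℝ M] {k : ℕ}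
    (f : M [⋀^Fin k]→ₗ[ℝ] ℝ) (A : Matrix (Fin k) (Fin k) ℝ) (b : Fin k → M) :
    f (fun i => ∑ j, A i j • b j) = A.det * f b := by
  let l := Fintype.linearCombination ℝ b
  have h : f.compLinearMap l (fun i => A i) = f.compLinearMap l (Pi.basisFun ℝ (Fin k))
      * (Pi.basisFun ℝ (Fin k)).det (fun i => A i) :=
    DFunLike.congr_fun ((f.compLinearMap l).eq_smul_basis_det (Pi.basisFun ℝ (Fin k))) _
  have hd : (Pi.basisFun ℝ (Fin k)).det (fun i => A i) = A.det := Pi.basisFun_det_apply A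
  have hb : f.compLinearMap l (Pi.basisFun ℝ (Fin k)) = f b := by
    rw [AlternatingMap.compLinearMap_apply]
    congr 1
    funext i
    simp [l, Fintype.linearCombination_apply, Pi.single_apply]
  rw [hd, hb] at h
  rw [mul_comm, ← h, AlternatingMap.compLinearMap_apply]
  rfl

/-- The transition matrix is orthogonal, and `d` is its determinant. One sign serves all forms at
once, so it can be read off from the orientation form and used for any other form. -/
theorem exists_sq_eq_one_of_orthonormal {k : ℕ} {e f : Fin k → R7} (he : Orthonormal ℝ e)
    (hf : Orthonormal ℝ f) (hspan : ∀ i, e i ∈ Submodule.span ℝ (range f)) :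
    ∃ d : ℝ, d ^ 2 = 1 ∧ ∀ α : R7 [⋀^Fin k]→L[ℝ] ℝ, α e = d * α f := by
  choose c hc using fun i => (Submodule.mem_span_range_iff_exists_fun ℝ).1 (hspan i)
  let A : Matrix (Fin k) (Fin k) ℝ := Matrix.of c
  have hA : A * A.transpose = 1 := by
    ext i j
    rw [Matrix.mul_apply, Matrix.one_apply, ← orthonormal_iff_ite.1 he i j, ← hc i, ← hc j,
      hf.inner_sum]
    simp [A]
  refine ⟨A.det, ?_, fun α => ?_⟩
  · have := congrArg Matrix.det hA
    rwa [Matrix.det_mul, Matrix.det_transpose, Matrix.det_one, ← sq] at this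
  · rw [← funext hc]
    exact map_sum_smul_eq_det_mul α.toAlternatingMap A f

/-- The basis chosen in the definition and `f` are both positive, so the sign relating them is `1`.
Pairing with a fixed vector reduces vector-valued forms to scalar ones. -/
theorem hodgeTop_eq {k : ℕ} {T : Submodule ℝ R7} {vol : R7 [⋀^Fin k]→L[ℝ] ℝ} {f : Fin k → R7}
    (hf : Orthonormal ℝ f) (hT : T = Submodule.span ℝ (range f)) (hvol : 0 < vol f)
    (α : R7 [⋀^Fin k]→L[ℝ] R7) : hodgeTop T vol α = α f := by
  have h : ∃ e : Fin k → R7, Orthonormal ℝ e ∧ (∀ i, e i ∈ T) ∧ 0 < vol e :=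
    ⟨f, hf, fun i => hT ▸ Submodule.subset_span (mem_range_self i), hvol⟩
  rw [hodgeTop, dif_pos h]
  obtain ⟨he, heT, hev⟩ := h.choose_spec
  obtain ⟨d, hd, hα⟩ := exists_sq_eq_one_of_orthonormal he hf (fun i => hT ▸ heT i)
  have hd1 : d = 1 := by
    rw [hα] at hev
    have := (pos_iff_pos_of_mul_pos hev).2 hvol
    nlinarith
  refine ext_inner_left ℝ fun n => ?_
  have := hα ((innerSL ℝ n).compContinuousAlternatingMap α)
  simpa [hd1] using this

theorem span_eq_of_orthonormal {k : ℕ} {T : Submodule ℝ R7} {e : Fin k → R7}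
    (he : Orthonormal ℝ e) (hT : ∀ i, e i ∈ T) (hk : Module.finrank ℝ T = k) :
    T = Submodule.span ℝ (range e) := by
  symm
  apply Submodule.eq_of_le_of_finrank_eq
  · rw [Submodule.span_le]
    rintro _ ⟨i, rfl⟩
    exact hT i
  · rw [finrank_span_eq_card he.linearIndependent, hk, Fintype.card_fin]

variable {L : Set R7}

theorem orthonormal_radial_frame (hLS : L ⊆ S6) {σ : R7} (hσ : σ ∈ L) {e : Fin 2 → R7}
    (he : Orthonormal ℝ e) (hT : ∀ i, e i ∈ tangent L σ) : Orthonormal ℝ ![σ, e 0, e 1] := by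
  have h1 := he.1
  have h2 : inner ℝ (e 0) (e 1) = 0 := he.2 (by decide)
  have h3 := inner_tangent_link hLS hσ (hT 0)
  have h4 := inner_tangent_link hLS hσ (hT 1)
  constructor
  · intro i
    fin_cases i
    · exact norm_eq_one_of_mem_link hLS hσ
    · exact h1 0
    · exact h1 1
  · intro i j hij
    fin_cases i <;> fin_cases j <;>
      first | exact absurd rfl hij | simpa using by first | assumption | (rw [real_inner_comm]; assumption)

theorem tangent_coneOver_eq_span (hLm : IsSmoothSubmanifold 2 L) (hLS : L ⊆ S6) {σ : R7}
    (hσ : σ ∈ L) {e : Fin 2 → R7} (he : Orthonormal ℝ e) (hT : ∀ i, e i ∈ tangent L σ) {r : ℝ}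
    (hr : 0 < r) :
    tangent (coneOver L) (r • σ) = Submodule.span ℝ (range ![σ, e 0, e 1]) := by
  rw [tangent_coneOver hLS hr hσ,
    span_eq_of_orthonormal he hT (finrank_tangent_link hLm hσ), ← Submodule.span_union]
  congr 1
  simp only [Matrix.range_cons, Matrix.range_empty, union_empty]
  congr 1
  ext x
  simp [Fin.exists_fin_two, eq_comm, or_comm]

/-- The associative basis supplied by the hypothesis differs from this frame by an orthogonal
matrix, so `φ` changes by a sign at most. -/
theorem phi_radial_frame (hLm : IsSmoothSubmanifold 2 L) (hLS : L ⊆ S6)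
    (hC : IsAssociative (coneOver L)) {σ : R7} (hσ : σ ∈ L) {e : Fin 2 → R7}
    (he : Orthonormal ℝ e) (hT : ∀ i, e i ∈ tangent L σ) : phi ![σ, e 0, e 1] ^ 2 = 1 := by
  have h1 : (1 : ℝ) • σ ∈ coneOver L := mem_coneOver one_pos hσ
  obtain ⟨f, hf, hfT, hfphi⟩ := hC.2 _ h1
  obtain ⟨d, hd, hα⟩ := exists_sq_eq_one_of_orthonormal hf (orthonormal_radial_frame hLS hσ he hT)
    (fun i => tangent_coneOver_eq_span hLm hLS hσ he hT one_pos ▸ hfT i)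
  have := hα phi
  rw [hfphi] at this
  have h3 : (d * phi ![σ, e 0, e 1]) ^ 2 = 1 := by rw [← this, one_pow]
  rwa [mul_pow, hd, one_mul] at h3

theorem exists_assocFrame (hLm : IsSmoothSubmanifold 2 L) (hLS : L ⊆ S6)
    (hC : IsAssociative (coneOver L)) {σ : R7} (hσ : σ ∈ L) :
    ∃ a b : R7, AssocFrame σ a b ∧ Orthonormal ℝ ![a, b] ∧
      tangent L σ = Submodule.span ℝ (range ![a, b]) := by
  have hfin := finrank_tangent_link hLm hσ
  let B := (stdOrthonormalBasis ℝ (tangent L σ)).reindex (finCongr hfin)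
  have hB : Orthonormal ℝ (fun i => (B i : R7)) :=
    B.orthonormal.comp_linearIsometry (tangent L σ).subtypeₗᵢ
  have key : ∀ e : Fin 2 → R7, Orthonormal ℝ e → (∀ i, e i ∈ tangent L σ) →
      0 < phi ![σ, e 0, e 1] → ∃ a b : R7, AssocFrame σ a b ∧ Orthonormal ℝ ![a, b] ∧
      tangent L σ = Submodule.span ℝ (range ![a, b]) := by
    intro e he hT hpos
    have hee : e = ![e 0, e 1] := by funext i; fin_cases i <;> rfl
    have h := orthonormal_iff_ite.1 (orthonormal_radial_frame hLS hσ he hT)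
    refine ⟨e 0, e 1, ⟨by simpa using h 0 0, by simpa using h 1 1, by simpa using h 2 2,
      by simpa using h 0 1, by simpa using h 0 2, by simpa using h 1 2, ?_⟩, hee ▸ he,
      hee ▸ span_eq_of_orthonormal he hT hfin⟩
    have := phi_radial_frame hLm hLS hC hσ he hT
    nlinarith
  have hsq := phi_radial_frame hLm hLS hC hσ hB (fun i => (B i).2)
  -- Only the orientation is left to arrange: swap the two vectors if `φ` is negative.
  rcases lt_trichotomy (phi ![σ, B 0, B 1]) 0 with h | h | h
  · refine key (fun i => (B (Equiv.swap 0 1 i) : R7))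
      (hB.comp _ (Equiv.injective _)) (fun i => (B _).2) ?_
    simp only [Equiv.swap_apply_left, Equiv.swap_apply_right]
    rw [phi_swap_right]
    linarith
  · rw [h] at hsq; norm_num at hsq
  · exact key _ hB (fun i => (B i).2) h

theorem AssocFrame.orthonormal {σ a b : R7} (h : AssocFrame σ a b) :
    Orthonormal ℝ ![σ, a, b] := by
  rw [orthonormal_iff_ite]
  intro i j
  fin_cases i <;> fin_cases j
  · simpa using h.norm_fst
  · simpa using h.fst_snd
  · simpa using h.fst_trd
  · simpa [real_inner_comm] using h.fst_snd
  · simpa using h.norm_snd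
  · simpa using h.snd_trd
  · simpa [real_inner_comm] using h.fst_trd
  · simpa [real_inner_comm] using h.snd_trd
  · simpa using h.norm_trd

theorem mem_normalSpace_of_frame (hLS : L ⊆ S6) {σ a b n : R7} (hσ : σ ∈ L)
    (hT : tangent L σ = Submodule.span ℝ (range ![a, b])) :
    n ∈ normalSpace S6 L σ ↔ inner ℝ σ n = 0 ∧ inner ℝ a n = 0 ∧ inner ℝ b n = 0 := by
  rw [mem_normalSpace_link hLS hσ, ← Submodule.mem_orthogonal, hT, Submodule.mem_orthogonal]
  refine and_congr_right fun _ => ⟨fun h => ⟨h a (Submodule.subset_span ⟨0, rfl⟩),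
    h b (Submodule.subset_span ⟨1, rfl⟩)⟩, fun h u hu => ?_⟩
  rw [Matrix.range_cons, Matrix.range_cons, Matrix.range_empty, union_empty,
    singleton_union, Submodule.mem_span_pair] at hu
  obtain ⟨s, t, rfl⟩ := hu
  simp [inner_add_left, real_inner_smul_left, h.1, h.2]

/-! ### Exterior derivatives evaluated on a frame -/

theorem fderivWithin_eq_of_tangent {F : Type*} [NormedAddCommGroup F] [NormedSpace ℝ F]
    {f : R7 → F} {f' : R7 →L[ℝ] F} {P : Set R7} {x u : R7}
    (hf : HasFDerivWithinAt f f' P x) (hu : u ∈ tangent P x) : fderivWithin ℝ f P x u = f' u :=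
  hasFDerivWithinAt_unique_tangent hf.differentiableWithinAt.hasFDerivWithinAt hf hu

theorem alternatizeUncurryFin_pair (T : R7 →L[ℝ] R7 [⋀^Fin 1]→L[ℝ] R7) (a b : R7) :
    ContinuousAlternatingMap.alternatizeUncurryFin T ![a, b] = T a ![b] - T b ![a] := by
  rw [ContinuousAlternatingMap.alternatizeUncurryFin_apply]
  refine (Fin.sum_univ_two _).trans ?_
  have e0 : Fin.removeNth (n := 1) 0 ![a, b] = ![b] := by funext i; fin_cases i; rfl
  have e1 : Fin.removeNth (n := 1) 1 ![a, b] = ![a] := by funext i; fin_cases i; rfl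
  rw [e0, e1]
  simp [sub_eq_add_neg]

theorem alternatizeUncurryFin_triple (T : R7 →L[ℝ] R7 [⋀^Fin 2]→L[ℝ] R7) (c a b : R7) :
    ContinuousAlternatingMap.alternatizeUncurryFin T ![c, a, b] =
      T c ![a, b] - T a ![c, b] + T b ![c, a] := by
  rw [ContinuousAlternatingMap.alternatizeUncurryFin_apply]
  refine (Fin.sum_univ_three _).trans ?_
  have e0 : Fin.removeNth (n := 2) 0 ![c, a, b] = ![a, b] := by funext i; fin_cases i <;> rfl
  have e1 : Fin.removeNth (n := 2) 1 ![c, a, b] = ![c, b] := by funext i; fin_cases i <;> rfl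
  have e2 : Fin.removeNth (n := 2) 2 ![c, a, b] = ![c, a] := by funext i; fin_cases i <;> rfl
  rw [e0, e1, e2]
  simp [sub_eq_add_neg]

/-- Each direction contributes two terms, since `f y (v y) ·` depends on the point both through `v`
and through the base point `y` itself. -/
theorem normalExtDeriv_curryLeft_curryLeft (M P : Set R7) (f : R7 [⋀^Fin 3]→L[ℝ] R7)
    {v : R7 → R7} {σ a b : R7} (hv : DifferentiableWithinAt ℝ v P σ)
    (ha : a ∈ tangent P σ) (hb : b ∈ tangent P σ) :
    normalExtDeriv M P (fun y => (f.curryLeft y).curryLeft (v y)) σ ![a, b] =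
      (normalSpace M P σ).starProjection
        (f ![σ, fderivWithin ℝ v P σ a, b] + f ![a, v σ, b]
          - (f ![σ, fderivWithin ℝ v P σ b, a] + f ![b, v σ, a])) := by
  let Z := (ContinuousAlternatingMap.curryLeftLI (𝕜 := ℝ) (E := R7) (F := R7)
      (n := 1)).toContinuousLinearMap.comp f.curryLeft
  have h := (Z.hasFDerivAt (x := σ)).hasFDerivWithinAt (s := P) |>.clm_apply hv.hasFDerivWithinAt
  have h' : HasFDerivWithinAt (fun y => (f.curryLeft y).curryLeft (v y)) _ P σ := h
  rw [normalExtDeriv, ContinuousLinearMap.compContinuousAlternatingMap_coe, Function.comp_apply,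
    extDerivWithin, alternatizeUncurryFin_pair, fderivWithin_eq_of_tangent h' ha,
    fderivWithin_eq_of_tangent h' hb]
  rfl

theorem normalExtDeriv_curryLeft (M P : Set R7) (f : R7 [⋀^Fin 3]→L[ℝ] R7) {v : R7 → R7}
    {x c a b : R7} (hv : DifferentiableWithinAt ℝ v P x)
    (hc : c ∈ tangent P x) (ha : a ∈ tangent P x) (hb : b ∈ tangent P x) :
    normalExtDeriv M P (fun y => f.curryLeft (v y)) x ![c, a, b] =
      (normalSpace M P x).starProjection
        (f ![fderivWithin ℝ v P x c, a, b] - f ![fderivWithin ℝ v P x a, c, b]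
          + f ![fderivWithin ℝ v P x b, c, a]) := by
  have h := f.curryLeft.hasFDerivAt.comp_hasFDerivWithinAt x hv.hasFDerivWithinAt
  have h' : HasFDerivWithinAt (fun y => f.curryLeft (v y)) _ P x := h
  rw [normalExtDeriv, ContinuousLinearMap.compContinuousAlternatingMap_coe, Function.comp_apply,
    extDerivWithin, alternatizeUncurryFin_triple, fderivWithin_eq_of_tangent h' ha,
    fderivWithin_eq_of_tangent h' hb, fderivWithin_eq_of_tangent h' hc]
  rfl

theorem mem_of_eq_span_pair {T : Submodule ℝ R7} {a b : R7}
    (hT : T = Submodule.span ℝ (range ![a, b])) : a ∈ T ∧ b ∈ T := by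
  rw [hT]
  exact ⟨Submodule.subset_span ⟨0, rfl⟩, Submodule.subset_span ⟨1, rfl⟩⟩

theorem diracLink_eq {v : R7 → R7} {σ a b : R7} (h : AssocFrame σ a b)
    (ho : Orthonormal ℝ ![a, b]) (hT : tangent L σ = Submodule.span ℝ (range ![a, b]))
    (hv : DifferentiableWithinAt ℝ v L σ) :
    diracLink L v σ = (normalSpace S6 L σ).starProjection
        (chi ![σ, fderivWithin ℝ v L σ a, b] + chi ![a, v σ, b]
          - (chi ![σ, fderivWithin ℝ v L σ b, a] + chi ![b, v σ, a])) := by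
  have hω : 0 < omega σ ![a, b] := by
    change 0 < phi ![σ, a, b]
    rw [h.phi_eq]; exact one_pos
  unfold diracLink zeta
  rw [hodgeTop_eq ho hT hω, normalExtDeriv_curryLeft_curryLeft _ _ _ hv (mem_of_eq_span_pair hT).1 (mem_of_eq_span_pair hT).2]

theorem diracAssoc_coneOver_eq (hLS : L ⊆ S6) {v : R7 → R7} {σ a b : R7} (hσ : σ ∈ L)
    (h : AssocFrame σ a b)
    (hT : tangent L σ = Submodule.span ℝ (range ![a, b]))
    {r : ℝ} (hr : 0 < r) (hv : DifferentiableWithinAt ℝ v (coneOver L) (r • σ)) :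
    diracAssoc (coneOver L) v (r • σ) = (normalSpace S6 L σ).starProjection
        (chi ![fderivWithin ℝ v (coneOver L) (r • σ) σ, a, b]
          - chi ![fderivWithin ℝ v (coneOver L) (r • σ) a, σ, b]
          + chi ![fderivWithin ℝ v (coneOver L) (r • σ) b, σ, a]) := by
  obtain ⟨haL, hbL⟩ := mem_of_eq_span_pair hT
  have hTC := tangent_coneOver hLS hr hσ
  have hs : σ ∈ tangent (coneOver L) (r • σ) := by
    rw [hTC]; exact Submodule.mem_sup_left (Submodule.mem_span_singleton_self σ)
  have ha : a ∈ tangent (coneOver L) (r • σ) := by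
    rw [hTC]; exact Submodule.mem_sup_right haL
  have hb : b ∈ tangent (coneOver L) (r • σ) := by
    rw [hTC]; exact Submodule.mem_sup_right hbL
  have ho3 := h.orthonormal
  have hT3 : tangent (coneOver L) (r • σ) = Submodule.span ℝ (range ![σ, a, b]) := by
    rw [hTC, hT, ← Submodule.span_union]
    congr 1
    simp only [Matrix.range_cons, Matrix.range_empty, union_empty]
  have hω : 0 < phi ![σ, a, b] := by rw [h.phi_eq]; exact one_pos
  have h1 := hodgeTop_eq ho3 hT3 hω
    (normalExtDeriv univ (coneOver L) (fun y => chi.curryLeft (v y)) (r • σ))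
  have h2 := normalExtDeriv_curryLeft univ (coneOver L) chi hv hs ha hb
  rw [normalSpace_coneOver hLS hr hσ] at h2
  exact h1.trans h2

/-! ### The operators in terms of a frame -/

theorem J_J_of_inner_eq_zero {σ n : R7} (hσ : ‖σ‖ = 1) (hn : inner ℝ σ n = 0) :
    cross σ (cross σ n) = -n := by
  rw [cross_cross_self, hn, real_inner_self_eq_norm_sq, hσ]
  simp

theorem cross_mem_normalSpace (hLS : L ⊆ S6) {σ a b n : R7} (hσ : σ ∈ L) (h : AssocFrame σ a b)
    (hT : tangent L σ = Submodule.span ℝ (range ![a, b])) (hn : n ∈ normalSpace S6 L σ) :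
    cross σ n ∈ normalSpace S6 L σ := by
  rw [mem_normalSpace_of_frame hLS hσ hT] at hn ⊢
  exact h.inner_cross_fst hn.2.1 hn.2.2

/-- The zeroth-order terms are `χ(a, v, b) = -J v` and `-χ(b, v, a) = -J v`, both already normal;
together they produce the factor `-2`. -/
theorem diracLink_eq_sub (hLS : L ⊆ S6) {v : R7 → R7} {σ a b : R7} (hσ : σ ∈ L)
    (h : AssocFrame σ a b) (ho : Orthonormal ℝ ![a, b])
    (hT : tangent L σ = Submodule.span ℝ (range ![a, b]))
    (hv : DifferentiableWithinAt ℝ v L σ) (hn : v σ ∈ normalSpace S6 L σ) :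
    diracLink L v σ = (normalSpace S6 L σ).starProjection
        (chi ![σ, fderivWithin ℝ v L σ a, b] - chi ![σ, fderivWithin ℝ v L σ b, a])
          - (2 : ℝ) • cross σ (v σ) := by
  obtain ⟨-, ha, hb⟩ := (mem_normalSpace_of_frame hLS hσ hT).1 hn
  have hP : (normalSpace S6 L σ).starProjection (cross σ (v σ)) = cross σ (v σ) :=
    Submodule.starProjection_eq_self_iff.2 (cross_mem_normalSpace hLS hσ h hT hn)
  rw [diracLink_eq h ho hT hv, chi_swap_left (v σ) a b, ← chi_cycle b (v σ) a, h.chi_fst ha hb]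
  simp only [map_add, map_sub, map_neg, hP]
  module

theorem dbarLink_eq_add (hLS : L ⊆ S6) {v : R7 → R7} {σ a b : R7} (hσ : σ ∈ L)
    (h : AssocFrame σ a b) (ho : Orthonormal ℝ ![a, b])
    (hT : tangent L σ = Submodule.span ℝ (range ![a, b]))
    (hv : DifferentiableWithinAt ℝ v L σ) (hn : v σ ∈ normalSpace S6 L σ) :
    dbarLink L v σ = cross σ ((normalSpace S6 L σ).starProjection
        (chi ![σ, fderivWithin ℝ v L σ a, b] - chi ![σ, fderivWithin ℝ v L σ b, a]))
          + (2 : ℝ) • v σ := by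
  have h0 := ((mem_normalSpace_of_frame hLS hσ hT).1 hn).1
  rw [dbarLink, J, diracLink_eq_sub hLS hσ h ho hT hv hn, sub_eq_add_neg, cross_add, cross_neg,
    cross_smul, J_J_of_inner_eq_zero (norm_eq_one_of_mem_link hLS hσ) h0]
  simp

theorem inner_starProjection_of_mem {K : Submodule ℝ R7} (x : R7) {n : R7} (hn : n ∈ K) :
    inner ℝ (K.starProjection x) n = inner ℝ x n := by
  rw [Submodule.inner_starProjection_left_eq_right, Submodule.starProjection_eq_self_iff.2 hn]

/-- Move `J` onto `n`, drop the projection because `J n` is normal, and then remove `J` again by the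
frame identities. What remains is a symmetric term of order zero and first-order terms in `φ` alone,
the form needed for integration by parts. -/
theorem inner_dbarLink (hLS : L ⊆ S6) {v : R7 → R7} {σ a b n : R7} (hσ : σ ∈ L)
    (h : AssocFrame σ a b) (ho : Orthonormal ℝ ![a, b])
    (hT : tangent L σ = Submodule.span ℝ (range ![a, b]))
    (hv : DifferentiableWithinAt ℝ v L σ) (hvn : v σ ∈ normalSpace S6 L σ)
    (hn : n ∈ normalSpace S6 L σ) :
    inner ℝ (dbarLink L v σ) n = 2 * inner ℝ (v σ) n + phi ![b, n, fderivWithin ℝ v L σ a]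
      - phi ![a, n, fderivWithin ℝ v L σ b] := by
  have hJ := cross_mem_normalSpace hLS hσ h hT hn
  obtain ⟨h1, h2, h3⟩ := (mem_normalSpace_of_frame hLS hσ hT).1 hn
  obtain ⟨k1, k2, k3⟩ := (mem_normalSpace_of_frame hLS hσ hT).1 hJ
  rw [dbarLink_eq_add hLS hσ h ho hT hv hvn, inner_add_left, inner_cross, phi_swap_right,
    ← inner_cross, real_inner_comm, inner_starProjection_of_mem _ hJ, inner_sub_left,
    h.inner_chi_fst_trd _ k1 k3, h.inner_chi_fst_snd _ k1 k2, h.phi_snd_cross _ h1 h2,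
    h.phi_trd_cross _ h1 h3, real_inner_smul_left]
  ring

theorem dbarLink_pairing_frame (hLS : L ⊆ S6) {v w : R7 → R7} {σ a b : R7} (hσ : σ ∈ L)
    (h : AssocFrame σ a b) (ho : Orthonormal ℝ ![a, b])
    (hT : tangent L σ = Submodule.span ℝ (range ![a, b]))
    (hv : v ∈ normalSections S6 L) (hw : w ∈ normalSections S6 L) :
    inner ℝ (dbarLink L v σ) (w σ) - inner ℝ (v σ) (dbarLink L w σ) =
      (phi ![fderivWithin ℝ v L σ b, w σ, a] + phi ![v σ, fderivWithin ℝ w L σ b, a])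
      - (phi ![fderivWithin ℝ v L σ a, w σ, b] + phi ![v σ, fderivWithin ℝ w L σ a, b]) := by
  rw [real_inner_comm (dbarLink L w σ),
    inner_dbarLink hLS hσ h ho hT (differentiable_of_mem hv hσ) (hv.2.1 σ hσ) (hw.2.1 σ hσ),
    inner_dbarLink hLS hσ h ho hT (differentiable_of_mem hw hσ) (hw.2.1 σ hσ) (hv.2.1 σ hσ),
    real_inner_comm (v σ) (w σ)]
  simp only [phi_apply]
  ring

/-- The failure of `∂̄` to be symmetric, times the area form, is the exterior derivative of the
1-form `φ(w, v, ·)`. -/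
theorem dbarLink_pairing (hLm : IsSmoothSubmanifold 2 L) (hLS : L ⊆ S6)
    (hC : IsAssociative (coneOver L)) {v w : R7 → R7} {σ : R7} (hσ : σ ∈ L)
    (hv : v ∈ normalSections S6 L) (hw : w ∈ normalSections S6 L) {p q : R7}
    (hp : p ∈ tangent L σ) (hq : q ∈ tangent L σ) :
    (inner ℝ (dbarLink L v σ) (w σ) - inner ℝ (v σ) (dbarLink L w σ)) * phi ![σ, p, q] =
      (phi ![fderivWithin ℝ v L σ q, w σ, p] + phi ![v σ, fderivWithin ℝ w L σ q, p])
      - (phi ![fderivWithin ℝ v L σ p, w σ, q] + phi ![v σ, fderivWithin ℝ w L σ p, q]) := by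
  obtain ⟨a, b, h, ho, hT⟩ := exists_assocFrame hLm hLS hC hσ
  rw [dbarLink_pairing_frame hLS hσ h ho hT hv hw]
  rw [hT, Matrix.range_cons, Matrix.range_cons, Matrix.range_empty, union_empty,
    singleton_union, Submodule.mem_span_pair] at hp hq
  obtain ⟨s, t, rfl⟩ := hp
  obtain ⟨s', t', rfl⟩ := hq
  -- Both sides are bilinear and alternating in `p, q`, so the identity on the frame `a, b`
  -- determines it on the whole tangent plane.
  have hadd (x y z z' : R7) (c c' : ℝ) :
      phi ![x, y, c • z + c' • z'] = c * phi ![x, y, z] + c' * phi ![x, y, z'] := by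
    simp only [← inner_cross, inner_add_right, real_inner_smul_right]
  have hadd2 (x y z z' : R7) (c c' : ℝ) :
      phi ![x, c • z + c' • z', y] = c * phi ![x, z, y] + c' * phi ![x, z', y] := by
    rw [phi_swap_right x y, hadd, phi_swap_right x z y, phi_swap_right x z' y]; ring
  have hadd1 (x y z z' : R7) (c c' : ℝ) :
      phi ![c • z + c' • z', x, y] = c * phi ![z, x, y] + c' * phi ![z', x, y] := by
    rw [phi_swap_left x, hadd2, phi_swap_left z x, phi_swap_left z' x]; ring
  simp only [map_add, map_smul, hadd, hadd2, hadd1, phi_self_right, h.phi_eq,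
    phi_swap_right σ a b]
  ring

/-! ### Radial and tangential derivatives on the cone -/

theorem fderivWithin_radial {v : R7 → R7} {σ : R7} (hσ : σ ∈ L) {r : ℝ} (hr : 0 < r) {d : R7}
    (hv : DifferentiableWithinAt ℝ v (coneOver L) (r • σ))
    (hd : HasDerivAt (fun t : ℝ => v (t • σ)) d r) :
    fderivWithin ℝ v (coneOver L) (r • σ) σ = d := by
  have h1 : HasDerivWithinAt (fun t : ℝ => t • σ) σ (Ioi 0) r := by
    simpa using ((hasDerivAt_id r).smul_const σ).hasDerivWithinAt
  have h2 := hv.hasFDerivWithinAt.comp_hasDerivWithinAt (t := coneOver L) r h1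
    (fun t ht => mem_coneOver ht hσ)
  exact (h2.hasDerivAt (Ioi_mem_nhds hr)).unique hd

/-- Differentiate `v (r • y) = c • V y` along the link with `r` fixed; the chain rule puts a factor
`r` on the left. -/
theorem fderivWithin_coneOver {v V : R7 → R7} {σ u : R7} {r c : ℝ}
    (hr : 0 < r) (hv : DifferentiableWithinAt ℝ v (coneOver L) (r • σ))
    (hV : DifferentiableWithinAt ℝ V L σ) (hσ : σ ∈ L) (hvV : ∀ y ∈ L, v (r • y) = c • V y)
    (hu : u ∈ tangent L σ) :
    fderivWithin ℝ v (coneOver L) (r • σ) u = (c / r) • fderivWithin ℝ V L σ u := by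
  have h1 : HasFDerivWithinAt (fun y : R7 => r • y) (r • ContinuousLinearMap.id ℝ R7) L σ :=
    ((hasFDerivAt_id σ).const_smul r).hasFDerivWithinAt
  have h2 := hv.hasFDerivWithinAt.comp σ h1 (fun y hy => mem_coneOver hr hy)
  have h3 : HasFDerivWithinAt (v ∘ fun y : R7 => r • y) (c • fderivWithin ℝ V L σ) L σ :=
    (hV.hasFDerivWithinAt.const_smul c).congr hvV (hvV σ hσ)
  have h4 := hasFDerivWithinAt_unique_tangent h2 h3 hu
  simp only [ContinuousLinearMap.comp_apply, smul_apply, ContinuousLinearMap.id_apply,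
    map_smul] at h4
  rw [div_eq_inv_mul, mul_smul, ← h4, smul_smul, inv_mul_cancel₀ hr.ne', one_smul]

/-- `D_C v = 0` at `rσ` in terms of the radial derivative of `v` and `∂̄` of its restriction to the
link of radius `r`. -/
theorem diracAssoc_coneOver_eq_zero_iff (hLm : IsSmoothSubmanifold 2 L) (hLS : L ⊆ S6)
    (hC : IsAssociative (coneOver L)) {v V : R7 → R7} {σ d : R7} {r c : ℝ} (hσ : σ ∈ L)
    (hr : 0 < r) (hv : DifferentiableWithinAt ℝ v (coneOver L) (r • σ))
    (hV : V ∈ normalSections S6 L) (hvV : ∀ y ∈ L, v (r • y) = c • V y)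
    (hd : HasDerivAt (fun t : ℝ => v (t • σ)) d r) (hdn : d ∈ normalSpace S6 L σ) :
    diracAssoc (coneOver L) v (r • σ) = 0 ↔
      d = (c / r) • (dbarLink L V σ - (2 : ℝ) • V σ) := by
  obtain ⟨a, b, h, ho, hT⟩ := exists_assocFrame hLm hLS hC hσ
  obtain ⟨haL, hbL⟩ := mem_of_eq_span_pair hT
  have hn := norm_eq_one_of_mem_link hLS hσ
  have hVd := differentiable_of_mem hV hσ
  obtain ⟨d0, da, db⟩ := (mem_normalSpace_of_frame hLS hσ hT).1 hdn
  have hsm (k : ℝ) (x y : R7) : chi ![σ, k • x, y] = k • chi ![σ, x, y] := by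
    rw [← chi_cycle, chi_eq, ← chi_cycle σ x y, chi_eq, cross_smul_left, real_inner_smul_left,
      real_inner_smul_left]
    module
  -- The radial derivative contributes `χ(d, a, b) = J d`; the two tangential ones contribute
  -- exactly the first-order part of the link operator, rescaled by `c / r`.
  have key : diracAssoc (coneOver L) v (r • σ) = cross σ d + (c / r) •
      (normalSpace S6 L σ).starProjection
        (chi ![σ, fderivWithin ℝ V L σ a, b] - chi ![σ, fderivWithin ℝ V L σ b, a]) := by
    rw [diracAssoc_coneOver_eq hLS hσ h hT hr hv, fderivWithin_radial hσ hr hv hd,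
      fderivWithin_coneOver hr hv hVd hσ hvV haL, fderivWithin_coneOver hr hv hVd hσ hvV hbL,
      h.chi_fst da db, chi_swap_left σ, chi_swap_left σ, hsm, hsm]
    have hP : (normalSpace S6 L σ).starProjection (cross σ d) = cross σ d :=
      Submodule.starProjection_eq_self_iff.2 (cross_mem_normalSpace hLS hσ h hT hdn)
    simp only [map_add, map_sub, map_neg, map_smul, hP]
    module
  rw [key, dbarLink_eq_add hLS hσ h ho hT hVd (hV.2.1 σ hσ), add_sub_cancel_right]
  set Q := (normalSpace S6 L σ).starProjection
        (chi ![σ, fderivWithin ℝ V L σ a, b] - chi ![σ, fderivWithin ℝ V L σ b, a])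
  have hQ : inner ℝ σ Q = 0 :=
    ((mem_normalSpace_of_frame hLS hσ hT).1 (Submodule.starProjection_apply_mem _ _)).1
  -- Both `d` and `Q` are orthogonal to `σ`, where `J` is inverted by `-J`.
  constructor
  · intro h0
    have := congrArg (cross σ) h0
    rw [cross_add, J_J_of_inner_eq_zero hn d0, cross_smul, cross_zero] at this
    rwa [neg_add_eq_zero] at this
  · intro h0
    rw [h0, cross_smul, J_J_of_inner_eq_zero hn hQ]
    simp

/-! ### Calculus of compactly supported functions on open sets -/

section Calculus

theorem integrableOn_of_eq_zero_off_compact {X : Type*} [TopologicalSpace X] [T2Space X]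
    [MeasurableSpace X] [BorelSpace X] {μ : Measure X} [IsFiniteMeasureOnCompacts μ] {U K : Set X}
    {f : X → ℝ} (hU : IsOpen U) (hK : IsCompact K) (hKU : K ⊆ U)
    (hf : ContinuousOn f U) (h0 : ∀ p ∈ U, p ∉ K → f p = 0) : IntegrableOn f U μ :=
  ((hf.mono hKU).integrableOn_compact hK).of_forall_sdiff_eq_zero hU.measurableSet
    fun p hp => h0 p hp.1 hp.2

variable {E : Type*} [NormedAddCommGroup E] [NormedSpace ℝ E] {U K : Set E} {f : E → ℝ}

/-- Extended by zero, `f` is `C¹` with compact support on the whole space; integrate by parts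
against the constant `1`. -/
theorem setIntegral_fderiv_eq_zero [FiniteDimensional ℝ E] [MeasurableSpace E] [BorelSpace E]
    {μ : Measure E} [μ.IsAddHaarMeasure] (hU : IsOpen U) (hK : IsCompact K) (hKU : K ⊆ U)
    (hf : ContDiffOn ℝ 1 f U) (h0 : ∀ p ∈ U, p ∉ K → f p = 0) (h : E) :
    ∫ p in U, fderiv ℝ f p h ∂μ = 0 := by
  set g : E → ℝ := U.indicator f with hg
  have hg0 : ∀ p, p ∉ K → g p = 0 := fun p hp => by
    by_cases hpU : p ∈ U
    · rw [hg, indicator_of_mem hpU, h0 p hpU hp]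
    · rw [hg, indicator_of_notMem hpU]
  have hgf : ∀ p ∈ U, g =ᶠ[nhds p] f := fun p hp => by
    filter_upwards [hU.mem_nhds hp] with q hq
    exact indicator_of_mem hq f
  have hgc : ContDiff ℝ 1 g := by
    rw [contDiff_iff_contDiffAt]
    intro p
    by_cases hp : p ∈ U
    · exact (hf.contDiffAt (hU.mem_nhds hp)).congr_of_eventuallyEq (hgf p hp)
    · have : g =ᶠ[nhds p] fun _ => 0 := by
        filter_upwards [hK.isClosed.isOpen_compl.mem_nhds (fun h => hp (hKU h))] with q hq
        exact hg0 q hq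
      exact contDiffAt_const.congr_of_eventuallyEq this
  have hcs : HasCompactSupport g := HasCompactSupport.intro hK hg0
  have h1 : ∫ p in U, fderiv ℝ f p h ∂μ = ∫ p in U, fderiv ℝ g p h ∂μ :=
    setIntegral_congr_fun hU.measurableSet fun p hp => by rw [(hgf p hp).fderiv_eq]
  have h2 : ∫ p in U, fderiv ℝ g p h ∂μ = ∫ p, fderiv ℝ g p h ∂μ := by
    refine setIntegral_eq_integral_of_forall_compl_eq_zero fun p hp => ?_
    have : g =ᶠ[nhds p] fun _ => 0 := by
      filter_upwards [hK.isClosed.isOpen_compl.mem_nhds (fun h => hp (hKU h))] with q hq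
      exact hg0 q hq
    rw [this.fderiv_eq]
    simp
  have hgi : Integrable g μ := hgc.continuous.integrable_of_hasCompactSupport hcs
  have hgi' : Integrable (fun p => fderiv ℝ g p h) μ :=
    ((hgc.continuous_fderiv (by simp)).clm_apply
      continuous_const).integrable_of_hasCompactSupport
      ((hcs.fderiv ℝ).comp_left (g := fun T : E →L[ℝ] ℝ => T h) (by simp))
  have h3 := integral_mul_fderiv_eq_neg_fderiv_mul_of_integrable (μ := μ) (f := fun _ => (1 : ℝ))
    (g := g) (v := h) (by simp) (by simpa using hgi') (by simpa using hgi)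
    (fun _ _ => differentiableAt_const _) (fun x _ => hgc.differentiable (by simp) x)
  rw [h1, h2]
  simpa using h3

theorem fderiv_phi {u v w : E → R7} {p : E} (hu : DifferentiableAt ℝ u p)
    (hv : DifferentiableAt ℝ v p) (hw : DifferentiableAt ℝ w p) (h : E) :
    fderiv ℝ (fun q => phi ![u q, v q, w q]) p h = phi ![fderiv ℝ u p h, v p, w p]
      + phi ![u p, fderiv ℝ v p h, w p] + phi ![u p, v p, fderiv ℝ w p h] := by
  have h1 : HasFDerivAt (fun q => ![u q, v q, w q])
      (ContinuousLinearMap.pi ![fderiv ℝ u p, fderiv ℝ v p, fderiv ℝ w p]) p := by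
    rw [hasFDerivAt_pi]
    intro i
    fin_cases i
    · exact hu.hasFDerivAt
    · exact hv.hasFDerivAt
    · exact hw.hasFDerivAt
  have h2 := (phi.hasFDerivAt ![u p, v p, w p]).comp p h1
  have h3 : HasFDerivAt (fun q => phi ![u q, v q, w q]) _ p := h2
  rw [h3.fderiv, ContinuousLinearMap.comp_apply, ContinuousMultilinearMap.linearDeriv_apply,
    Fin.sum_univ_three]
  have e (f : R7 [⋀^Fin 3]→L[ℝ] ℝ) (a b c a' b' c' : R7) :
      f.1 (Function.update ![a, b, c] 0 a') = f ![a', b, c] ∧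
      f.1 (Function.update ![a, b, c] 1 b') = f ![a, b', c] ∧
      f.1 (Function.update ![a, b, c] 2 c') = f ![a, b, c'] := by
    refine ⟨?_, ?_, ?_⟩ <;>
    · change f _ = f _
      congr 1
      funext i
      fin_cases i <;> rfl
  obtain ⟨e0, -, -⟩ := e phi (u p) (v p) (w p) (fderiv ℝ u p h) 0 0
  obtain ⟨-, e1, -⟩ := e phi (u p) (v p) (w p) 0 (fderiv ℝ v p h) 0
  obtain ⟨-, -, e2⟩ := e phi (u p) (v p) (w p) 0 0 (fderiv ℝ w p h)
  rw [← e0, ← e1, ← e2]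
  rfl

theorem contDiffOn_phi {n : WithTop ℕ∞} {u v w : E → R7} (hu : ContDiffOn ℝ n u U)
    (hv : ContDiffOn ℝ n v U) (hw : ContDiffOn ℝ n w U) :
    ContDiffOn ℝ n (fun q => phi ![u q, v q, w q]) U := by
  have h1 : ContDiffOn ℝ n (fun q => ![u q, v q, w q]) U := by
    rw [contDiffOn_pi]
    intro i
    fin_cases i
    · exact hu
    · exact hv
    · exact hw
  exact phi.toContinuousMultilinearMap.contDiff.comp_contDiffOn h1

end Calculus

/-! ### Integration over the link -/

namespace LocalParam

variable (P Q : LocalParam L) {p : ℝ × ℝ}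

/-- The coefficient of the pullback of the form `ω` to the parameter domain. -/
noncomputable def area (p : ℝ × ℝ) : ℝ :=
  phi ![P.par p, fderiv ℝ P.par p (1, 0), fderiv ℝ P.par p (0, 1)]

theorem contDiffOn_fderiv_par (h : ℝ × ℝ) : ContDiffOn ℝ ∞ (fun p => fderiv ℝ P.par p h) P.dom :=
  (P.contDiffOn_par.fderiv_of_isOpen P.isOpen_dom (by simp)).clm_apply contDiffOn_const

theorem continuousOn_area : ContinuousOn P.area P.dom :=
  (contDiffOn_phi P.contDiffOn_par (P.contDiffOn_fderiv_par _)
    (P.contDiffOn_fderiv_par _)).continuousOn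

/-- Writing `a, b` in the coordinate basis turns `φ(σ, a, b) = 1` into a determinant times the area
coefficient, so neither factor vanishes. -/
theorem area_ne_zero (hLm : IsSmoothSubmanifold 2 L) (hLS : L ⊆ S6)
    (hC : IsAssociative (coneOver L)) (hp : p ∈ P.dom) : P.area p ≠ 0 := by
  obtain ⟨a, b, h, -, hT⟩ := exists_assocFrame hLm hLS hC (P.par_mem p hp)
  obtain ⟨ha, hb⟩ := mem_of_eq_span_pair hT
  rw [P.tangent_eq_span hp, Submodule.mem_span_pair] at ha hb
  obtain ⟨s, t, rfl⟩ := ha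
  obtain ⟨s', t', rfl⟩ := hb
  intro h0
  have h1 := h.phi_eq
  have h2 : phi ![P.par p,
      s • fderiv ℝ P.par p (1, 0) + t • fderiv ℝ P.par p (0, 1),
      s' • fderiv ℝ P.par p (1, 0) + t' • fderiv ℝ P.par p (0, 1)]
      = (s * t' - t * s') * P.area p := by
    simp only [area, phi_apply, PiLp.add_apply, PiLp.smul_apply, smul_eq_mul]
    ring
  rw [h2, h0, mul_zero] at h1
  exact zero_ne_one h1

/-- A continuous nowhere vanishing function on a connected domain has constant sign `ε`. Thus the
density `|area|` is a constant multiple of the smooth coefficient, and divergence formulas survive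
the absolute value. -/
theorem exists_abs_area_eq (hLm : IsSmoothSubmanifold 2 L) (hLS : L ⊆ S6)
    (hC : IsAssociative (coneOver L)) : ∃ ε : ℝ, ∀ p ∈ P.dom, |P.area p| = ε * P.area p := by
  have key : ∀ p ∈ P.dom, ∀ q ∈ P.dom, P.area p < 0 → ¬ 0 < P.area q := by
    intro p hp q hq h1 h2
    obtain ⟨s, hs, hs0⟩ := P.isPreconnected_dom.intermediate_value hp hq P.continuousOn_area
      (mem_Icc.2 ⟨h1.le, h2.le⟩)
    exact P.area_ne_zero hLm hLS hC hs hs0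
  by_cases h : ∃ p ∈ P.dom, P.area p < 0
  · obtain ⟨p, hp, hneg⟩ := h
    exact ⟨-1, fun q hq => by rw [abs_of_nonpos (not_lt.1 (key p hp q hq hneg)), neg_one_mul]⟩
  · push Not at h
    exact ⟨1, fun q hq => by rw [abs_of_nonneg (h q hq), one_mul]⟩

/-- The area coefficients of two local parametrizations differ by the Jacobian of the transition
map. -/
theorem area_eq_det_mul (hp : p ∈ P.dom) (hpQ : P.par p ∈ Q.nbhd) :
    P.area p = ((fderiv ℝ Q.coord (P.par p)).comp (fderiv ℝ P.par p)).det
      * Q.area (Q.coord (P.par p)) := by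
  set T := (fderiv ℝ Q.coord (P.par p)).comp (fderiv ℝ P.par p) with hT
  have hL := P.par_mem p hp
  have hq := Q.coord_mem _ hL hpQ
  have hQ := Q.par_coord _ hL hpQ
  have hcomp : ∀ h, fderiv ℝ P.par p h = fderiv ℝ Q.par (Q.coord (P.par p)) (T h) := fun h => by
    have := Q.fderiv_par_fderiv_coord hq (u := fderiv ℝ P.par p h)
      (by rw [hQ]; exact P.fderiv_par_mem_tangent hp h)
    rw [hQ] at this
    exact this.symm
  have hdet : T.det = (T (1, 0)).1 * (T (0, 1)).2 - (T (0, 1)).1 * (T (1, 0)).2 := by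
    rw [ContinuousLinearMap.det, ← LinearMap.det_toMatrix (Module.Basis.finTwoProd ℝ),
      Matrix.det_fin_two]
    simp [LinearMap.toMatrix_apply]
  have hexp : ∀ h : ℝ × ℝ, fderiv ℝ Q.par (Q.coord (P.par p)) h =
      h.1 • fderiv ℝ Q.par (Q.coord (P.par p)) (1, 0)
        + h.2 • fderiv ℝ Q.par (Q.coord (P.par p)) (0, 1) := fun h => by
    rw [← map_smul, ← map_smul, ← map_add]
    congr 1
    ext <;> simp
  rw [area, area, hcomp, hcomp, hQ, hexp (T (1, 0)), hexp (T (0, 1)), hdet]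
  simp only [phi_apply, PiLp.add_apply, PiLp.smul_apply, smul_eq_mul]
  ring

/-- Both integrals live on the overlap of the two charts, where the transition map and its Jacobian
relate them. The change of variables formula asks no regularity of `f`. -/
theorem setIntegral_area_eq {f : R7 → ℝ} (hP : ∀ σ ∈ L, σ ∉ P.nbhd → f σ = 0)
    (hQ : ∀ σ ∈ L, σ ∉ Q.nbhd → f σ = 0) :
    ∫ p in P.dom, f (P.par p) * |P.area p| = ∫ q in Q.dom, f (Q.par q) * |Q.area q| := by
  have hopen : ∀ P Q : LocalParam L, IsOpen (P.dom ∩ P.par ⁻¹' Q.nbhd) := fun P Q =>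
    P.contDiffOn_par.continuousOn.isOpen_inter_preimage P.isOpen_dom Q.isOpen_nbhd
  have himage : (fun p => Q.coord (P.par p)) '' (P.dom ∩ P.par ⁻¹' Q.nbhd)
      = Q.dom ∩ Q.par ⁻¹' P.nbhd := by
    ext q
    constructor
    · rintro ⟨p, ⟨hp, hpQ⟩, rfl⟩
      refine ⟨Q.coord_mem _ (P.par_mem p hp) hpQ, ?_⟩
      rw [mem_preimage, Q.par_coord _ (P.par_mem p hp) hpQ]
      exact P.par_mem_nbhd p hp
    · rintro ⟨hq, hqP⟩
      have h1 := P.par_coord _ (Q.par_mem q hq) hqP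
      refine ⟨P.coord (Q.par q), ⟨P.coord_mem _ (Q.par_mem q hq) hqP, ?_⟩, ?_⟩
      · rw [mem_preimage, h1]
        exact Q.par_mem_nbhd q hq
      · simp only [h1, Q.coord_par q hq]
  have hinj : InjOn (fun p => Q.coord (P.par p)) (P.dom ∩ P.par ⁻¹' Q.nbhd) := by
    rintro p ⟨hp, hpQ⟩ q ⟨hq, hqQ⟩ hpq
    have h1 := congrArg Q.par hpq
    simp only [Q.par_coord _ (P.par_mem p hp) hpQ, Q.par_coord _ (P.par_mem q hq) hqQ] at h1
    rw [← P.coord_par p hp, h1, P.coord_par q hq]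
  have hderiv : ∀ p ∈ P.dom ∩ P.par ⁻¹' Q.nbhd, HasFDerivWithinAt (fun p => Q.coord (P.par p))
      ((fderiv ℝ Q.coord (P.par p)).comp (fderiv ℝ P.par p)) (P.dom ∩ P.par ⁻¹' Q.nbhd) p := by
    rintro p ⟨hp, hpQ⟩
    have h1 : HasFDerivAt Q.coord (fderiv ℝ Q.coord (P.par p)) (P.par p) :=
      ((Q.contDiffOn_coord.contDiffAt (Q.isOpen_nbhd.mem_nhds hpQ)).differentiableAt
        (by simp)).hasFDerivAt
    exact (h1.comp p (P.hasFDerivAt_par hp)).hasFDerivWithinAt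
  have hcv := integral_image_eq_integral_abs_det_fderiv_smul volume (hopen P Q).measurableSet
    hderiv hinj (fun q => f (Q.par q) * |Q.area q|)
  have hP' : ∫ p in P.dom, f (P.par p) * |P.area p|
      = ∫ p in P.dom ∩ P.par ⁻¹' Q.nbhd, f (P.par p) * |P.area p| :=
    setIntegral_eq_of_subset_of_forall_sdiff_eq_zero P.isOpen_dom.measurableSet inter_subset_left
      fun p hp => by rw [hQ _ (P.par_mem p hp.1) (fun h => hp.2 ⟨hp.1, h⟩), zero_mul]
  have hQ' : ∫ q in Q.dom, f (Q.par q) * |Q.area q|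
      = ∫ q in Q.dom ∩ Q.par ⁻¹' P.nbhd, f (Q.par q) * |Q.area q| :=
    setIntegral_eq_of_subset_of_forall_sdiff_eq_zero Q.isOpen_dom.measurableSet inter_subset_left
      fun q hq => by rw [hP _ (Q.par_mem q hq.1) (fun h => hq.2 ⟨hq.1, h⟩), zero_mul]
  rw [hP', hQ', ← himage, hcv]
  refine setIntegral_congr_fun (hopen P Q).measurableSet ?_
  rintro p ⟨hp, hpQ⟩
  simp only [smul_eq_mul]
  rw [Q.par_coord _ (P.par_mem p hp) hpQ, P.area_eq_det_mul Q hp hpQ, abs_mul]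
  ring

theorem isCompact_coord_image (hLc : IsCompact L) {S : Set R7} (hS : IsClosed S)
    (hSP : S ⊆ P.nbhd) : IsCompact (P.coord '' (L ∩ S)) :=
  (hLc.inter_right hS).image_of_continuousOn
    (P.contDiffOn_coord.continuousOn.mono (inter_subset_right.trans hSP))

theorem coord_image_subset {S : Set R7} (hSP : S ⊆ P.nbhd) : P.coord '' (L ∩ S) ⊆ P.dom := by
  rintro _ ⟨x, hx, rfl⟩
  exact P.coord_mem x hx.1 (hSP hx.2)

theorem par_notMem_of_notMem {S : Set R7} (hp : p ∈ P.dom) (hpS : p ∉ P.coord '' (L ∩ S)) :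
    P.par p ∉ S :=
  fun h => hpS ⟨P.par p, ⟨P.par_mem p hp, h⟩, P.coord_par p hp⟩

theorem contDiffOn_comp_par {M : Set R7} {v : R7 → R7} (hv : v ∈ normalSections M L) :
    ContDiffOn ℝ ∞ (fun p => v (P.par p)) P.dom :=
  hv.1.comp P.contDiffOn_par P.par_mem

theorem fderiv_comp_par {v : R7 → R7} (hp : p ∈ P.dom)
    (hv : DifferentiableWithinAt ℝ v L (P.par p)) (h : ℝ × ℝ) :
    fderiv ℝ (fun p => v (P.par p)) p h = fderivWithin ℝ v L (P.par p) (fderiv ℝ P.par p h) := by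
  have h1 := hv.hasFDerivWithinAt.comp p (P.hasFDerivAt_par hp).hasFDerivWithinAt P.par_mem
  have h2 : HasFDerivAt (fun p => v (P.par p)) _ p := h1.hasFDerivAt (P.isOpen_dom.mem_nhds hp)
  rw [h2.fderiv]
  rfl

/-- Symmetry of the second derivative: it cancels the second derivatives of `par` in the exterior
derivative of the pulled-back 1-form. -/
theorem fderiv_fderiv_par_comm (hp : p ∈ P.dom) (h k : ℝ × ℝ) :
    fderiv ℝ (fun p => fderiv ℝ P.par p h) p k = fderiv ℝ (fun p => fderiv ℝ P.par p k) p h := by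
  have hc := P.contDiffOn_par.contDiffAt (P.isOpen_dom.mem_nhds hp)
  have hd : DifferentiableAt ℝ (fderiv ℝ P.par) p :=
    (hc.fderiv_right (m := 1) (by norm_cast)).differentiableAt (by simp)
  have h1 (l : ℝ × ℝ) : fderiv ℝ (fun p => fderiv ℝ P.par p l) p
      = (fderiv ℝ (fderiv ℝ P.par) p).flip l := by
    have := hd.hasFDerivAt.clm_apply (hasFDerivAt_const l p)
    simpa using this.fderiv
  rw [h1, h1]
  exact hc.isSymmSndFDerivAt (by
    rw [minSmoothness_of_isRCLikeNormedField]
    exact WithTop.coe_le_coe.2 (le_top (a := (2 : ℕ∞)))) k h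

end LocalParam

/-! ### Linearity of `∂̄` and its symmetry defect -/

theorem dbarLink_add {v w : R7 → R7} {σ : R7} (hv : DifferentiableWithinAt ℝ v L σ)
    (hw : DifferentiableWithinAt ℝ w L σ) :
    dbarLink L (v + w) σ = dbarLink L v σ + dbarLink L w σ := by
  simp only [dbarLink, J, diracLink_add hv hw, cross_add]

theorem dbarLink_smul {v : R7 → R7} {σ : R7} (c : ℝ) (hv : DifferentiableWithinAt ℝ v L σ) :
    dbarLink L (c • v) σ = c • dbarLink L v σ := by
  simp only [dbarLink, J, diracLink_smul c hv, cross_smul]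

theorem dbarLink_zero (σ : R7) : dbarLink L 0 σ = 0 := by
  simpa using dbarLink_smul (L := L) (v := 0) (σ := σ) 0 (differentiableWithinAt_const 0)

theorem dbarLink_sum {ι : Type*} (s : Finset ι) {v : ι → R7 → R7} {σ : R7} (hσ : σ ∈ L)
    (hv : ∀ i ∈ s, v i ∈ normalSections S6 L) :
    dbarLink L (∑ i ∈ s, v i) σ = ∑ i ∈ s, dbarLink L (v i) σ := by
  classical
  induction s using Finset.induction_on with
  | empty => simpa using dbarLink_zero σ
  | insert i s hi ih =>
    have hs := fun j hj => hv j (Finset.mem_insert_of_mem hj)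
    rw [Finset.sum_insert hi, Finset.sum_insert hi, dbarLink_add
      (differentiable_of_mem (hv i (Finset.mem_insert_self i s)) hσ)
      (differentiable_of_mem (Submodule.sum_mem _ hs) hσ), ih hs]

/-- The failure of `∂̄` to be symmetric, as a function on the link. -/
noncomputable def asymmetry (L : Set R7) (v w : R7 → R7) (σ : R7) : ℝ :=
  inner ℝ (dbarLink L v σ) (w σ) - inner ℝ (v σ) (dbarLink L w σ)

theorem asymmetry_sum {ι : Type*} (s : Finset ι) {v : ι → R7 → R7} {w : R7 → R7} {σ : R7}
    (hσ : σ ∈ L) (hv : ∀ i ∈ s, v i ∈ normalSections S6 L) :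
    asymmetry L (∑ i ∈ s, v i) w σ = ∑ i ∈ s, asymmetry L (v i) w σ := by
  simp only [asymmetry, dbarLink_sum s hσ hv, Finset.sum_apply, sum_inner,
    Finset.sum_sub_distrib]

theorem asymmetry_eq_zero_of_eventuallyEq (hLm : IsSmoothSubmanifold 2 L) (hLS : L ⊆ S6)
    (hC : IsAssociative (coneOver L)) {v w : R7 → R7} {σ : R7} (hσ : σ ∈ L)
    (hv : v ∈ normalSections S6 L) (hw : w ∈ normalSections S6 L)
    (h0 : v =ᶠ[nhdsWithin σ L] 0) : asymmetry L v w σ = 0 := by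
  obtain ⟨a, b, h, ho, hT⟩ := exists_assocFrame hLm hLS hC hσ
  have h1 : fderivWithin ℝ v L σ = 0 := by
    rw [h0.fderivWithin_eq_of_mem hσ]
    change fderivWithin ℝ (fun _ => (0 : R7)) L σ = 0
    simp
  have h2 : v σ = 0 := h0.eq_of_nhdsWithin hσ
  rw [asymmetry, dbarLink_pairing_frame hLS hσ h ho hT hv hw, h1, h2]
  simp [phi_apply]

theorem smul_mem_normalSections {M : Set R7} {v : R7 → R7} (hv : v ∈ normalSections M L)
    {ρ : R7 → ℝ} (hρ : ContDiff ℝ ∞ ρ) : (fun x => ρ x • v x) ∈ normalSections M L :=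
  ⟨hρ.contDiffOn.smul hv.1, fun x hx => Submodule.smul_mem _ _ (hv.2.1 x hx),
    fun x hx => by simp [hv.2.2 x hx]⟩

namespace LocalParam

variable (P : LocalParam L) {p : ℝ × ℝ}

theorem contDiffOn_form {v w : R7 → R7} (hv : v ∈ normalSections S6 L)
    (hw : w ∈ normalSections S6 L) (h : ℝ × ℝ) :
    ContDiffOn ℝ ∞ (fun q => phi ![v (P.par q), w (P.par q), fderiv ℝ P.par q h]) P.dom :=
  contDiffOn_phi (P.contDiffOn_comp_par hv) (P.contDiffOn_comp_par hw)
    (P.contDiffOn_fderiv_par h)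

/-- In a local parametrization the failure of `∂̄` to be symmetric is a divergence. -/
theorem asymmetry_mul_area (hLm : IsSmoothSubmanifold 2 L) (hLS : L ⊆ S6)
    (hC : IsAssociative (coneOver L)) {v w : R7 → R7} (hv : v ∈ normalSections S6 L)
    (hw : w ∈ normalSections S6 L) (hp : p ∈ P.dom) :
    asymmetry L v w (P.par p) * P.area p =
      fderiv ℝ (fun q => phi ![v (P.par q), w (P.par q), fderiv ℝ P.par q (1, 0)]) p (0, 1)
      - fderiv ℝ (fun q => phi ![v (P.par q), w (P.par q), fderiv ℝ P.par q (0, 1)]) p (1, 0) := by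
  have hd {F : Type} [NormedAddCommGroup F] [NormedSpace ℝ F] {f : ℝ × ℝ → F}
      (hf : ContDiffOn ℝ ∞ f P.dom) : DifferentiableAt ℝ f p :=
    (hf.contDiffAt (P.isOpen_dom.mem_nhds hp)).differentiableAt (by simp)
  have hL := P.par_mem p hp
  rw [fderiv_phi (hd (P.contDiffOn_comp_par hv)) (hd (P.contDiffOn_comp_par hw))
      (hd (P.contDiffOn_fderiv_par _)),
    fderiv_phi (hd (P.contDiffOn_comp_par hv)) (hd (P.contDiffOn_comp_par hw))
      (hd (P.contDiffOn_fderiv_par _)), P.fderiv_fderiv_par_comm hp (1, 0) (0, 1)]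
  simp only [P.fderiv_comp_par hp (differentiable_of_mem hv hL),
    P.fderiv_comp_par hp (differentiable_of_mem hw hL)]
  rw [asymmetry, area, dbarLink_pairing hLm hLS hC hL hv hw (P.fderiv_par_mem_tangent hp _)
    (P.fderiv_par_mem_tangent hp _)]
  ring

theorem continuousOn_asymmetry_mul_abs_area (hLm : IsSmoothSubmanifold 2 L) (hLS : L ⊆ S6)
    (hC : IsAssociative (coneOver L)) {v w : R7 → R7} (hv : v ∈ normalSections S6 L)
    (hw : w ∈ normalSections S6 L) :
    ContinuousOn (fun p => asymmetry L v w (P.par p) * |P.area p|) P.dom := by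
  obtain ⟨ε, hε⟩ := P.exists_abs_area_eq hLm hLS hC
  have hc (h k : ℝ × ℝ) : ContinuousOn (fun p => fderiv ℝ
      (fun q => phi ![v (P.par q), w (P.par q), fderiv ℝ P.par q h]) p k) P.dom :=
    ((P.contDiffOn_form hv hw h).continuousOn_fderiv_of_isOpen P.isOpen_dom
      (by simp)).clm_apply continuousOn_const
  refine (((hc (1, 0) (0, 1)).sub (hc (0, 1) (1, 0))).const_smul ε).congr fun p hp => ?_
  simp only [Pi.smul_apply, Pi.sub_apply, smul_eq_mul]
  rw [hε p hp, ← P.asymmetry_mul_area hLm hLS hC hv hw hp]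
  ring

/-- Stokes in one chart: the cut-off of `v` makes the 1-form vanish outside a compact subset of the
domain, so each part of the divergence integrates to zero. -/
theorem setIntegral_asymmetry_eq_zero (hLm : IsSmoothSubmanifold 2 L) (hLS : L ⊆ S6)
    (hC : IsAssociative (coneOver L)) (hLc : IsCompact L) {v w : R7 → R7}
    (hv : v ∈ normalSections S6 L) (hw : w ∈ normalSections S6 L) {S : Set R7} (hS : IsClosed S)
    (hSP : S ⊆ P.nbhd) (hvS : ∀ x, x ∉ S → v x = 0) :
    ∫ p in P.dom, asymmetry L v w (P.par p) * |P.area p| = 0 := by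
  obtain ⟨ε, hε⟩ := P.exists_abs_area_eq hLm hLS hC
  have hK := P.isCompact_coord_image hLc hS hSP
  have hKP := P.coord_image_subset hSP
  have h0 (h : ℝ × ℝ) : ∀ p ∈ P.dom, p ∉ P.coord '' (L ∩ S) →
      phi ![v (P.par p), w (P.par p), fderiv ℝ P.par p h] = 0 := fun p hp hpK => by
    rw [hvS _ (P.par_notMem_of_notMem hp hpK)]
    simp [phi_apply]
  have hz (h k : ℝ × ℝ) : ∫ p in P.dom, fderiv ℝ
      (fun q => phi ![v (P.par q), w (P.par q), fderiv ℝ P.par q h]) p k = 0 :=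
    setIntegral_fderiv_eq_zero P.isOpen_dom hK hKP
      ((P.contDiffOn_form hv hw h).of_le (by norm_cast)) (h0 h) k
  have hi (h k : ℝ × ℝ) : IntegrableOn (fun p => fderiv ℝ
      (fun q => phi ![v (P.par q), w (P.par q), fderiv ℝ P.par q h]) p k) P.dom := by
    refine integrableOn_of_eq_zero_off_compact P.isOpen_dom hK hKP
      (((P.contDiffOn_form hv hw h).continuousOn_fderiv_of_isOpen P.isOpen_dom
        (by simp)).clm_apply continuousOn_const) fun p hp hpK => ?_
    have : (fun q => phi ![v (P.par q), w (P.par q), fderiv ℝ P.par q h])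
        =ᶠ[nhds p] fun _ => 0 := by
      filter_upwards [P.isOpen_dom.mem_nhds hp, hK.isClosed.isOpen_compl.mem_nhds hpK]
        with q hq hqK
      exact h0 h q hq hqK
    rw [this.fderiv_eq]
    simp
  have h1 : ∫ p in P.dom, asymmetry L v w (P.par p) * |P.area p| = ∫ p in P.dom, ε *
      (fderiv ℝ (fun q => phi ![v (P.par q), w (P.par q), fderiv ℝ P.par q (1, 0)]) p (0, 1)
      - fderiv ℝ (fun q => phi ![v (P.par q), w (P.par q), fderiv ℝ P.par q (0, 1)]) p
        (1, 0)) := by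
    refine setIntegral_congr_fun P.isOpen_dom.measurableSet fun p hp => ?_
    rw [hε p hp, ← P.asymmetry_mul_area hLm hLS hC hv hw hp]
    ring
  rw [h1, integral_const_mul, integral_sub (hi _ _) (hi _ _), hz, hz]
  simp

end LocalParam

/-! ### Partition of unity and `L²` symmetry on the compact link -/

open scoped Manifold in
theorem exists_finite_partition (hLc : IsCompact L) (hLm : IsSmoothSubmanifold 2 L) :
    ∃ (n : ℕ) (P : Fin n → LocalParam L) (ρ : Fin n → R7 → ℝ), (∀ i, ContDiff ℝ ∞ (ρ i)) ∧
      (∀ i, tsupport (ρ i) ⊆ (P i).nbhd) ∧ (∀ i x, 0 ≤ ρ i x) ∧ ∀ x ∈ L, ∑ i, ρ i x = 1 := by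
  choose P hP using fun x : L => hLm.exists_localParam x.2
  obtain ⟨t, ht⟩ := hLc.elim_finite_subcover (fun x => (P x).nbhd) (fun x => (P x).isOpen_nbhd)
    (fun x hx => mem_iUnion.2 ⟨⟨x, hx⟩, hP ⟨x, hx⟩⟩)
  let e := t.equivFin.symm
  obtain ⟨f, hf⟩ := SmoothPartitionOfUnity.exists_isSubordinate 𝓘(ℝ, R7) hLc.isClosed
    (fun i : Fin t.card => (P (e i)).nbhd) (fun i => (P (e i)).isOpen_nbhd) (fun x hx => by
      obtain ⟨y, hy, hxy⟩ := mem_iUnion₂.1 (ht hx)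
      exact mem_iUnion.2 ⟨e.symm ⟨y, hy⟩, by simpa using hxy⟩)
  refine ⟨t.card, fun i => P (e i), fun i => f i, fun i => (f i).contMDiff.contDiff, hf,
    fun i x => f.nonneg i x, fun x hx => ?_⟩
  rw [← finsum_eq_sum_of_fintype]
  exact f.sum_eq_one hx

/-- A consequence of the symmetry of `∂̄` for the `L²` inner product on the compact link. -/
theorem eq_zero_of_asymmetry_eq_mul_norm_sq (hLc : IsCompact L) (hLm : IsSmoothSubmanifold 2 L)
    (hLS : L ⊆ S6) (hC : IsAssociative (coneOver L)) {v w : R7 → R7}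
    (hv : v ∈ normalSections S6 L) (hw : w ∈ normalSections S6 L) {m : ℝ} (hm : m ≠ 0)
    (h : ∀ σ ∈ L, asymmetry L v w σ = m * ‖w σ‖ ^ 2) : w = 0 := by
  obtain ⟨n, P, ρ, hρ, hρP, hρ0, hρ1⟩ := exists_finite_partition hLc hLm
  have hρ0' : ∀ i, ∀ x, x ∉ tsupport (ρ i) → ρ i x = 0 := fun i x hx =>
    image_eq_zero_of_notMem_tsupport hx
  -- Only `v` is localized; the defect is additive in it, and `w` stays global.
  let u : Fin n → R7 → R7 := fun j x => ρ j x • v x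
  have hu : ∀ j, u j ∈ normalSections S6 L := fun j => smul_mem_normalSections hv (hρ j)
  have hsum : ∑ j, u j = v := by
    funext x
    rw [Finset.sum_apply]
    change ∑ j, ρ j x • v x = v x
    rw [← Finset.sum_smul]
    by_cases hx : x ∈ L
    · rw [hρ1 x hx, one_smul]
    · rw [hv.2.2 x hx, smul_zero]
  have hG0 : ∀ j, ∀ σ ∈ L, σ ∉ tsupport (ρ j) → asymmetry L (u j) w σ = 0 := by
    intro j σ hσ hn
    refine asymmetry_eq_zero_of_eventuallyEq hLm hLS hC hσ (hu j) hw
      (Filter.Eventually.filter_mono nhdsWithin_le_nhds ?_)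
    filter_upwards [(isClosed_tsupport (ρ j)).isOpen_compl.mem_nhds hn] with x hx
    simp [u, hρ0' j x hx]
  have hcont : ∀ i j k, ContinuousOn (fun p => ρ i ((P k).par p) *
      (asymmetry L (u j) w ((P k).par p) * |(P k).area p|)) (P k).dom := fun i j k =>
    ((hρ i).continuous.comp_continuousOn (P k).contDiffOn_par.continuousOn).mul
      ((P k).continuousOn_asymmetry_mul_abs_area hLm hLS hC (hu j) hw)
  have hint : ∀ i j k, k = i ∨ k = j → IntegrableOn (fun p => ρ i ((P k).par p) *
      (asymmetry L (u j) w ((P k).par p) * |(P k).area p|)) (P k).dom := by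
    intro i j k hk
    refine integrableOn_of_eq_zero_off_compact (P k).isOpen_dom
      ((P k).isCompact_coord_image hLc (isClosed_tsupport (ρ k)) (hρP k))
      ((P k).coord_image_subset (hρP k)) (hcont i j k) fun p hp hpK => ?_
    have hn := (P k).par_notMem_of_notMem hp hpK
    rcases hk with rfl | rfl
    · rw [hρ0' _ _ hn, zero_mul]
    · rw [hG0 _ _ ((P k).par_mem p hp) hn, zero_mul, mul_zero]
  -- The integrand vanishes off the neighbourhood of chart `i` because of `ρ i`, and off that of
  -- chart `j` because of `u j`, so it may be integrated in either chart.
  have hij : ∀ i j, ∫ p in (P i).dom, ρ i ((P i).par p) *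
      (asymmetry L (u j) w ((P i).par p) * |(P i).area p|) = ∫ p in (P j).dom,
      ρ i ((P j).par p) * (asymmetry L (u j) w ((P j).par p) * |(P j).area p|) := by
    intro i j
    have := (P i).setIntegral_area_eq (P j) (f := fun σ => ρ i σ * asymmetry L (u j) w σ)
      (fun σ _ hn => by rw [hρ0' i σ (fun h => hn (hρP i h)), zero_mul])
      (fun σ hσ hn => by rw [hG0 j σ hσ (fun h => hn (hρP j h)), mul_zero])
    simpa only [mul_assoc] using this
  -- The integral over the link is the `ρ`-weighted sum over charts. Split `v` into the `u j`,
  -- exchange the sums, move everything for `u j` to chart `j`, and sum the weights `ρ i` to `1`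
  -- there; Stokes in chart `j` finishes.
  have htotal : ∑ i, ∫ p in (P i).dom, ρ i ((P i).par p) *
      (asymmetry L v w ((P i).par p) * |(P i).area p|) = 0 := by
    have h1 : ∀ i, ∫ p in (P i).dom, ρ i ((P i).par p) *
        (asymmetry L v w ((P i).par p) * |(P i).area p|) = ∑ j, ∫ p in (P i).dom,
        ρ i ((P i).par p) * (asymmetry L (u j) w ((P i).par p) * |(P i).area p|) := by
      intro i
      rw [← integral_finsetSum _ fun j _ => hint i j i (Or.inl rfl)]
      refine setIntegral_congr_fun (P i).isOpen_dom.measurableSet fun p hp => ?_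
      rw [← Finset.mul_sum, ← Finset.sum_mul,
        ← asymmetry_sum _ ((P i).par_mem p hp) (fun j _ => hu j), hsum]
    rw [Finset.sum_congr rfl fun i _ => h1 i, Finset.sum_comm]
    refine Finset.sum_eq_zero fun j _ => ?_
    rw [Finset.sum_congr rfl fun i _ => hij i j,
      ← integral_finsetSum _ fun i _ => hint i j j (Or.inr rfl),
      ← (P j).setIntegral_asymmetry_eq_zero hLm hLS hC hLc (hu j) hw (isClosed_tsupport (ρ j))
        (hρP j) (fun x hx => by simp [u, hρ0' j x hx])]
    refine setIntegral_congr_fun (P j).isOpen_dom.measurableSet fun p hp => ?_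
    rw [← Finset.sum_mul, hρ1 _ ((P j).par_mem p hp), one_mul]
  -- Substituting the hypothesis leaves nonnegative integrals with sum zero, so each integrand
  -- vanishes almost everywhere and, being continuous, everywhere on its chart.
  have hw0 : ∀ i, EqOn (fun p => ρ i ((P i).par p) * (‖w ((P i).par p)‖ ^ 2 * |(P i).area p|)) 0
      (P i).dom := by
    have hc : ∀ i, ContinuousOn
        (fun p => ρ i ((P i).par p) * (‖w ((P i).par p)‖ ^ 2 * |(P i).area p|)) (P i).dom :=
      fun i => ((hρ i).continuous.comp_continuousOn (P i).contDiffOn_par.continuousOn).mul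
        ((((P i).contDiffOn_comp_par hw).continuousOn.norm.pow 2).mul (P i).continuousOn_area.abs)
    have hi : ∀ i, IntegrableOn
        (fun p => ρ i ((P i).par p) * (‖w ((P i).par p)‖ ^ 2 * |(P i).area p|)) (P i).dom :=
      fun i => integrableOn_of_eq_zero_off_compact (P i).isOpen_dom
        ((P i).isCompact_coord_image hLc (isClosed_tsupport (ρ i)) (hρP i))
        ((P i).coord_image_subset (hρP i)) (hc i) fun p hp hpK => by
          rw [hρ0' i _ ((P i).par_notMem_of_notMem hp hpK), zero_mul]
    have hnn : ∀ i p, 0 ≤ ρ i ((P i).par p) * (‖w ((P i).par p)‖ ^ 2 * |(P i).area p|) :=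
      fun i p => mul_nonneg (hρ0 i _) (by positivity)
    have hs : ∑ i, ∫ p in (P i).dom,
        ρ i ((P i).par p) * (‖w ((P i).par p)‖ ^ 2 * |(P i).area p|) = 0 := by
      have h1 : ∀ i, ∫ p in (P i).dom, ρ i ((P i).par p) *
          (asymmetry L v w ((P i).par p) * |(P i).area p|) = m * ∫ p in (P i).dom,
          ρ i ((P i).par p) * (‖w ((P i).par p)‖ ^ 2 * |(P i).area p|) := by
        intro i
        rw [← integral_const_mul]
        refine setIntegral_congr_fun (P i).isOpen_dom.measurableSet fun p hp => ?_
        rw [h _ ((P i).par_mem p hp)]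
        ring
      rw [Finset.sum_congr rfl fun i _ => h1 i, ← Finset.mul_sum] at htotal
      exact (mul_eq_zero.1 htotal).resolve_left hm
    intro i
    have h2 := (Finset.sum_eq_zero_iff_of_nonneg
      (fun i _ => integral_nonneg (hnn i))).1 hs i (Finset.mem_univ i)
    rw [setIntegral_eq_zero_iff_of_nonneg_ae (Filter.Eventually.of_forall (hnn i)) (hi i)] at h2
    exact Measure.eqOn_open_of_ae_eq h2 (P i).isOpen_dom (hc i) continuousOn_const
  funext x
  by_cases hx : x ∈ L
  · have h3 : ∀ i, ρ i x * ‖w x‖ ^ 2 = 0 := by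
      intro i
      by_cases hxi : x ∈ (P i).nbhd
      · have hp := (P i).coord_mem x hx hxi
        have h4 := hw0 i hp
        simp only [(P i).par_coord x hx hxi, Pi.zero_apply, ← mul_assoc] at h4
        exact (mul_eq_zero.1 h4).resolve_right
          (abs_ne_zero.2 ((P i).area_ne_zero hLm hLS hC hp))
      · rw [hρ0' i x (fun h => hxi (hρP i h)), zero_mul]
    have h5 : ∑ i, ρ i x * ‖w x‖ ^ 2 = 0 := Finset.sum_eq_zero fun i _ => h3 i
    rw [← Finset.sum_mul, hρ1 x hx, one_mul] at h5
    simpa using h5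
  · exact hw.2.2 x hx

/-! ### Logarithmic expansions -/

variable {μ : ℝ}

theorem zero_notMem_link (hLS : L ⊆ S6) : (0 : R7) ∉ L := fun h => by
  simpa using norm_eq_one_of_mem_link hLS h

theorem finsupp_sum_eq_sum_range (a : ℕ →₀ normalSections S6 L) {N : ℕ}
    (hN : ∀ j, N ≤ j → a j = 0) (l : ℝ) (σ : R7) :
    (a.sum fun j w => l ^ j • (w : R7 → R7) σ)
      = ∑ j ∈ Finset.range N, l ^ j • (a j : R7 → R7) σ := by
  refine Finsupp.sum_of_support_subset _ (fun j hj => ?_) _ (fun j _ => by simp)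
  rw [Finset.mem_range]
  by_contra hNj
  exact Finsupp.mem_support_iff.1 hj (hN j (not_lt.1 hNj))

theorem exists_forall_ge_eq_zero (a : ℕ →₀ normalSections S6 L) :
    ∃ N : ℕ, ∀ j, N ≤ j → a j = 0 := by
  refine ⟨a.support.sup id + 1, fun j hj => ?_⟩
  by_contra h
  have := Finset.le_sup (f := id) (Finsupp.mem_support_iff.2 h)
  simp only [id] at this
  omega

/-- The recursion between the coefficients of a logarithmic solution. -/
theorem dbarLink_coeff (hLm : IsSmoothSubmanifold 2 L) (hLS : L ⊆ S6)
    (hC : IsAssociative (coneOver L)) {v : R7 → R7} (hv : v ∈ logSolutions L μ)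
    {a : ℕ →₀ normalSections S6 L} (ha : HasLogExpansion L μ v a) {σ : R7} (hσ : σ ∈ L) (j : ℕ) :
    dbarLink L (a j) σ
      = (μ + 1) • (a j : R7 → R7) σ + ((j : ℝ) + 1) • (a (j + 1) : R7 → R7) σ := by
  obtain ⟨hvC, -, hv0⟩ := hv
  obtain ⟨N, hN⟩ := exists_forall_ge_eq_zero a
  have hexp : ∀ r : ℝ, 0 < r → ∀ τ ∈ L, v (r • τ) = r ^ (μ - 1) •
      ∑ j ∈ Finset.range N, Real.log r ^ j • (a j : R7 → R7) τ := fun r hr τ hτ => by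
    rw [ha r hr τ hτ, finsupp_sum_eq_sum_range a hN]
  -- With `r = exp l` the equation `D_C v = 0` holds for every real `l = log r`, hence as an
  -- identity between polynomials in `l`.
  have key : ∀ l : ℝ, ∑ j ∈ Finset.range N, l ^ j • dbarLink L (a j) σ
      = (μ + 1) • ∑ j ∈ Finset.range N, l ^ j • (a j : R7 → R7) σ
        + ∑ j ∈ Finset.range N, ((j : ℝ) * l ^ (j - 1)) • (a j : R7 → R7) σ := by
    intro l
    set r := Real.exp l with hrdef
    have hr : 0 < r := Real.exp_pos l
    have hl : Real.log r = l := Real.log_exp l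
    let V : R7 → R7 := ∑ j ∈ Finset.range N, l ^ j • (a j : R7 → R7)
    have haj : ∀ j ∈ Finset.range N, l ^ j • (a j : R7 → R7) ∈ normalSections S6 L :=
      fun j _ => Submodule.smul_mem _ _ (a j).2
    have hV : V ∈ normalSections S6 L := Submodule.sum_mem _ haj
    have hVσ : V σ = ∑ j ∈ Finset.range N, l ^ j • (a j : R7 → R7) σ := by
      simp [V, Finset.sum_apply]
    -- `W` is the derivative of `V σ` with respect to `l`; at `j = 0` the truncated exponent is
    -- harmless because of the factor `j`.
    let W : R7 := ∑ j ∈ Finset.range N, ((j : ℝ) * l ^ (j - 1)) • (a j : R7 → R7) σ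
    have hW : W ∈ normalSpace S6 L σ :=
      Submodule.sum_mem _ fun j _ => Submodule.smul_mem _ _ ((a j).2.2.1 σ hσ)
    have hvV : ∀ y ∈ L, v (r • y) = r ^ (μ - 1) • V y := fun y hy => by
      rw [hexp r hr y hy, hl]
      simp [V, Finset.sum_apply]
    have hdsum : HasDerivAt (fun t : ℝ => ∑ j ∈ Finset.range N, Real.log t ^ j •
        (a j : R7 → R7) σ) (r⁻¹ • W) r := by
      have : r⁻¹ • W = ∑ j ∈ Finset.range N,
          ((j : ℝ) * Real.log r ^ (j - 1) * r⁻¹) • (a j : R7 → R7) σ := by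
        rw [Finset.smul_sum, hl]
        exact Finset.sum_congr rfl fun j _ => by rw [smul_smul, mul_comm]
      rw [this]
      exact HasDerivAt.fun_sum fun j _ => ((Real.hasDerivAt_log hr.ne').pow j).smul_const _
    have hd : HasDerivAt (fun t : ℝ => v (t • σ))
        (r ^ (μ - 1) • (r⁻¹ • W) + ((μ - 1) * r ^ (μ - 1 - 1)) • V σ) r := by
      have h1 := (Real.hasDerivAt_rpow_const (p := μ - 1) (Or.inl hr.ne')).smul hdsum
      rw [hl, ← hVσ] at h1
      refine h1.congr_of_eventuallyEq ?_
      filter_upwards [Ioi_mem_nhds hr] with t ht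
      exact hexp t ht σ hσ
    have hdn : r ^ (μ - 1) • (r⁻¹ • W) + ((μ - 1) * r ^ (μ - 1 - 1)) • V σ
        ∈ normalSpace S6 L σ :=
      Submodule.add_mem _ (Submodule.smul_mem _ _ (Submodule.smul_mem _ _ hW))
        (Submodule.smul_mem _ _ (hV.2.1 σ hσ))
    have hx := mem_coneOver hr hσ
    have h2 := (diracAssoc_coneOver_eq_zero_iff hLm hLS hC hσ hr (differentiable_of_mem hvC hx)
      hV hvV hd hdn).1 (hv0 _ hx)
    have hc : r ^ (μ - 1) / r ≠ 0 := (div_pos (Real.rpow_pos_of_pos hr _) hr).ne'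
    have h3 : r ^ (μ - 1) • (r⁻¹ • W) + ((μ - 1) * r ^ (μ - 1 - 1)) • V σ
        = (r ^ (μ - 1) / r) • (W + (μ - 1) • V σ) := by
      rw [Real.rpow_sub_one hr.ne' (μ - 1), smul_add, smul_smul, smul_smul, ← div_eq_mul_inv,
        mul_comm (μ - 1)]
    rw [h3] at h2
    have h4 := smul_right_injective R7 hc h2
    have h5 : dbarLink L V σ = ∑ j ∈ Finset.range N, l ^ j • dbarLink L (a j) σ := by
      rw [dbarLink_sum _ hσ haj]
      exact Finset.sum_congr rfl fun j _ => dbarLink_smul _ (differentiable_of_mem (a j).2 hσ)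
    rw [← h5, ← hVσ]
    change dbarLink L V σ = (μ + 1) • V σ + W
    rw [eq_sub_iff_add_eq] at h4
    rw [← h4]
    module
  ext k
  -- In each coordinate the identity reads `q = (μ + 1) p + p'`. The coefficient of degree `j` in
  -- `p'` is the source of the factor `j + 1`.
  let p : Polynomial ℝ := ∑ j ∈ Finset.range N, Polynomial.monomial j ((a j : R7 → R7) σ k)
  let q : Polynomial ℝ := ∑ j ∈ Finset.range N, Polynomial.monomial j (dbarLink L (a j) σ k)
  have hpq : q = Polynomial.C (μ + 1) * p + Polynomial.derivative p := by
    refine Polynomial.funext fun l => ?_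
    have := congrArg (fun x : R7 => x k) (key l)
    simp only [PiLp.add_apply, PiLp.smul_apply, WithLp.ofLp_sum, Finset.sum_apply,
      smul_eq_mul] at this
    simp only [p, q, Polynomial.eval_add, Polynomial.eval_mul, Polynomial.eval_C,
      Polynomial.eval_finsetSum, Polynomial.eval_monomial, Polynomial.derivative_sum,
      Polynomial.derivative_monomial]
    have e1 (c : ℕ → ℝ) : ∑ j ∈ Finset.range N, c j * l ^ j = ∑ j ∈ Finset.range N, l ^ j * c j :=
      Finset.sum_congr rfl fun j _ => mul_comm _ _
    have e2 (c : ℕ → ℝ) : ∑ j ∈ Finset.range N, c j * (j : ℝ) * l ^ (j - 1)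
        = ∑ j ∈ Finset.range N, (j : ℝ) * l ^ (j - 1) * c j :=
      Finset.sum_congr rfl fun j _ => by ring
    rw [e1, e1, e2]
    exact this
  have hcoeff (c : ℕ → ℝ) (hc : ∀ j, N ≤ j → c j = 0) (i : ℕ) :
      (∑ j ∈ Finset.range N, Polynomial.monomial j (c j)).coeff i = c i := by
    simp only [Polynomial.finsetSum_coeff, Polynomial.coeff_monomial, Finset.sum_ite_eq',
      Finset.mem_range]
    split_ifs with h
    · rfl
    · exact (hc i (not_lt.1 h)).symm
  have hp := hcoeff (fun j => (a j : R7 → R7) σ k) (fun j hj => by simp [hN j hj])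
  have hq := hcoeff (fun j => dbarLink L (a j) σ k) (fun j hj => by
    simp only [hN j hj, Submodule.coe_zero, dbarLink_zero, PiLp.zero_apply])
  have h1 := congrArg (fun f => Polynomial.coeff f j) hpq
  simp only [Polynomial.coeff_add, Polynomial.coeff_C_mul, Polynomial.coeff_derivative, p, q,
    hp, hq] at h1
  simp only [PiLp.add_apply, PiLp.smul_apply, smul_eq_mul]
  rw [h1]
  ring

/-- Downward induction from the top of the chain. Once the coefficient of index `i + 2` vanishes,
that of index `i + 1` is an eigenfield, the eigenvalue terms cancel in the defect, and `(i + 1) |a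
(i + 1)|²` remains. -/
theorem coeff_eq_zero (hLc : IsCompact L) (hLm : IsSmoothSubmanifold 2 L) (hLS : L ⊆ S6)
    (hC : IsAssociative (coneOver L)) {a : ℕ →₀ normalSections S6 L}
    (h : ∀ σ ∈ L, ∀ j, dbarLink L (a j) σ
      = (μ + 1) • (a j : R7 → R7) σ + ((j : ℝ) + 1) • (a (j + 1) : R7 → R7) σ) (j : ℕ) :
    a (j + 1) = 0 := by
  obtain ⟨N, hN⟩ := exists_forall_ge_eq_zero a
  by_cases hj : N ≤ j + 1
  · exact hN _ hj
  refine Nat.decreasingInduction' (P := fun j => a (j + 1) = 0) (m := j) (n := N)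
    (fun i _ _ hi => ?_) (by omega) (hN _ (Nat.le_succ N))
  have hm : (i : ℝ) + 1 ≠ 0 := by positivity
  refine Subtype.ext (eq_zero_of_asymmetry_eq_mul_norm_sq hLc hLm hLS hC (a i).2 (a (i + 1)).2
    hm fun σ hσ => ?_)
  rw [asymmetry, h σ hσ i, h σ hσ (i + 1), hi]
  simp only [inner_add_left, inner_add_right, real_inner_smul_left, real_inner_smul_right,
    Submodule.coe_zero, Pi.zero_apply, inner_zero_right, real_inner_self_eq_norm_sq]
  ring

theorem hasLogExpansion_coeff (hLc : IsCompact L) (hLm : IsSmoothSubmanifold 2 L) (hLS : L ⊆ S6)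
    (hC : IsAssociative (coneOver L)) {v : R7 → R7} (hv : v ∈ logSolutions L μ)
    {a : ℕ →₀ normalSections S6 L} (ha : HasLogExpansion L μ v a) :
    (∀ j : ℕ, 1 ≤ j → a j = 0) ∧ (a 0 : R7 → R7) ∈ eigenspaceD L μ := by
  have h := fun σ hσ j => dbarLink_coeff hLm hLS hC hv ha (σ := σ) hσ j
  have h0 := coeff_eq_zero hLc hLm hLS hC h
  refine ⟨fun j hj => ?_, (a 0).2, fun σ hσ => ?_⟩
  · obtain ⟨i, rfl⟩ := Nat.exists_eq_add_of_le' hj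
    exact h0 i
  · rw [h σ hσ 0, h0 0]
    simp

/-! ### Homogeneous extension to the cone -/

/-- The extension of a vector field on the link to a field homogeneous of degree `μ - 1` on the
cone. -/
noncomputable def homogeneousExt (μ : ℝ) (w : R7 → R7) (x : R7) : R7 :=
  ‖x‖ ^ (μ - 1) • w (‖x‖⁻¹ • x)

theorem homogeneousExt_smul (hLS : L ⊆ S6) (w : R7 → R7) {r : ℝ} (hr : 0 < r) {σ : R7}
    (hσ : σ ∈ L) : homogeneousExt μ w (r • σ) = r ^ (μ - 1) • w σ := by
  rw [homogeneousExt, norm_smul, norm_eq_one_of_mem_link hLS hσ, mul_one, Real.norm_of_nonneg hr.le,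
    smul_smul, inv_mul_cancel₀ hr.ne', one_smul]

theorem homogeneousExt_mem_normalSections (hLS : L ⊆ S6) {w : R7 → R7}
    (hw : w ∈ normalSections S6 L) :
    homogeneousExt μ w ∈ normalSections univ (coneOver L) := by
  have hne : ∀ x ∈ coneOver L, x ≠ 0 := by
    rintro _ ⟨r, hr, σ, hσ, rfl⟩
    refine smul_ne_zero hr.ne' ?_
    rintro rfl
    exact zero_notMem_link hLS hσ
  refine ⟨?_, ?_, ?_⟩
  · have hnorm : ContDiffOn ℝ ∞ (fun x : R7 => ‖x‖) (coneOver L) := fun x hx =>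
      (contDiffAt_norm ℝ (hne x hx)).contDiffWithinAt
    refine (hnorm.rpow_const_of_ne fun x hx => norm_ne_zero_iff.2 (hne x hx)).smul
      (hw.1.comp ((hnorm.inv fun x hx => norm_ne_zero_iff.2 (hne x hx)).smul contDiffOn_id) ?_)
    rintro _ ⟨r, hr, σ, hσ, rfl⟩
    simpa [norm_smul, norm_eq_one_of_mem_link hLS hσ, abs_of_pos hr, smul_smul, hr.ne'] using hσ
  · rintro _ ⟨r, hr, σ, hσ, rfl⟩
    rw [homogeneousExt_smul hLS w hr hσ, normalSpace_coneOver hLS hr hσ]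
    exact Submodule.smul_mem _ _ (hw.2.1 σ hσ)
  · intro x hx
    -- At the origin the argument of `w` is `0`, which is not on the link, so the value is zero
    -- whatever the power of `‖0‖` is.
    by_cases hx0 : x = 0
    · rw [homogeneousExt, hx0, smul_zero, hw.2.2 0 (zero_notMem_link hLS), smul_zero]
    · have hn : 0 < ‖x‖ := norm_pos_iff.2 hx0
      rw [homogeneousExt, hw.2.2 (‖x‖⁻¹ • x), smul_zero]
      intro h
      exact hx ⟨‖x‖, hn, _, h, by rw [smul_smul, mul_inv_cancel₀ hn.ne', one_smul]⟩

theorem homogeneousExt_mem_logSolutions (hLm : IsSmoothSubmanifold 2 L) (hLS : L ⊆ S6)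
    (hC : IsAssociative (coneOver L)) {w : R7 → R7} (hw : w ∈ eigenspaceD L μ) :
    homogeneousExt μ w ∈ logSolutions L μ := by
  have hm := homogeneousExt_mem_normalSections (μ := μ) hLS hw.1
  refine ⟨hm, ⟨Finsupp.single 0 ⟨w, hw.1⟩, fun r hr σ hσ => ?_⟩, ?_⟩
  · rw [homogeneousExt_smul hLS w hr hσ, Finsupp.sum_single_index (by simp)]
    simp
  · rintro _ ⟨r, hr, σ, hσ, rfl⟩
    have hd : HasDerivAt (fun t : ℝ => homogeneousExt μ w (t • σ))
        (((μ - 1) * r ^ (μ - 1 - 1)) • w σ) r := by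
      refine ((Real.hasDerivAt_rpow_const (p := μ - 1) (Or.inl hr.ne')).smul_const
        (w σ)).congr_of_eventuallyEq ?_
      filter_upwards [Ioi_mem_nhds hr] with t ht
      exact homogeneousExt_smul hLS w ht hσ
    rw [diracAssoc_coneOver_eq_zero_iff hLm hLS hC hσ hr
      (differentiable_of_mem hm (mem_coneOver hr hσ)) hw.1
      (fun y hy => homogeneousExt_smul hLS w hr hy) hd
      (Submodule.smul_mem _ _ (hw.1.2.1 σ hσ)), hw.2 σ hσ, Real.rpow_sub_one hr.ne']
    module

/-- The homogeneous extension as a linear map into the logarithmic solutions. -/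
noncomputable def homogeneousExtLinear (hLm : IsSmoothSubmanifold 2 L) (hLS : L ⊆ S6)
    (hC : IsAssociative (coneOver L)) : eigenspaceD L μ →ₗ[ℝ] logSolutions L μ where
  toFun w := ⟨homogeneousExt μ w, homogeneousExt_mem_logSolutions hLm hLS hC w.2⟩
  map_add' v w := Subtype.ext (funext fun x => by simp [homogeneousExt])
  map_smul' c w := Subtype.ext (funext fun x => by simp [homogeneousExt, smul_comm c])

/-- Injectivity is seen at `r = 1`. For surjectivity, a solution without logarithms is the
homogeneous extension of its leading coefficient. Off the link and the cone, all fields vanish by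
convention. -/
theorem homogeneousExtLinear_bijective (hLc : IsCompact L) (hLm : IsSmoothSubmanifold 2 L)
    (hLS : L ⊆ S6) (hC : IsAssociative (coneOver L)) :
    Function.Bijective (homogeneousExtLinear (μ := μ) hLm hLS hC) := by
  constructor
  · intro w w' h
    refine Subtype.ext (funext fun x => ?_)
    by_cases hx : x ∈ L
    · have h1 : homogeneousExt μ w ((1 : ℝ) • x) = homogeneousExt μ w' ((1 : ℝ) • x) :=
        congrFun (congrArg Subtype.val h) ((1 : ℝ) • x)
      rw [homogeneousExt_smul hLS _ one_pos hx, homogeneousExt_smul hLS _ one_pos hx,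
        Real.one_rpow, one_smul, one_smul] at h1
      exact h1
    · rw [w.2.1.2.2 x hx, w'.2.1.2.2 x hx]
  · intro v
    obtain ⟨a, ha⟩ := v.2.2.1
    obtain ⟨h1, h2⟩ := hasLogExpansion_coeff hLc hLm hLS hC v.2 ha
    refine ⟨⟨a 0, h2⟩, Subtype.ext (funext fun x => ?_)⟩
    change homogeneousExt μ (a 0) x = (v : R7 → R7) x
    by_cases hx : x ∈ coneOver L
    · obtain ⟨r, hr, σ, hσ, rfl⟩ := hx
      rw [homogeneousExt_smul hLS _ hr hσ, ha r hr σ hσ,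
        finsupp_sum_eq_sum_range a (N := 1) h1]
      simp
    · rw [v.2.1.2.2 x hx, (homogeneousExt_mem_normalSections hLS h2.1).2.2 x hx]

end AssocCone

theorem proposition5p4 (L : Set AssocCone.R7) (hLc : IsCompact L)
    (hLm : AssocCone.IsSmoothSubmanifold 2 L) (hLS : L ⊆ AssocCone.S6)
    (hC : AssocCone.IsAssociative (AssocCone.coneOver L)) (μ : ℝ) :
    (∀ v ∈ AssocCone.logSolutions L μ, ∀ a : ℕ →₀ AssocCone.normalSections AssocCone.S6 L,
      AssocCone.HasLogExpansion L μ v a →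
        (∀ j : ℕ, 1 ≤ j → a j = 0) ∧
          (a 0 : AssocCone.R7 → AssocCone.R7) ∈ AssocCone.eigenspaceD L μ) ∧
    Module.rank ℝ (AssocCone.logSolutions L μ) = Module.rank ℝ (AssocCone.eigenspaceD L μ) := by
  -- The isomorphism equates the ranks as cardinals, so finiteness of the dimensions plays no role.
  exact ⟨fun v hv a ha => AssocCone.hasLogExpansion_coeff hLc hLm hLS hC hv ha,
    (LinearEquiv.ofBijective _ (AssocCone.homogeneousExtLinear_bijective (μ := μ) hLc hLm hLS
      hC)).rank_eq.symm⟩
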